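/- **Conventions.** A *coherence space* $\mathbf X=(X,\sim)$ is a countable set $X$ of tokens with a reflexive symmetric relation $\sim$. We also write $\mathbf X$ for the set of its cliques (sets of pairwise coherent tokens), ordered by inclusion. Two cliques are coherent if their union is a clique. A map $F:\mathbf X\to\mathbf Y$ between sets of cliques is *stable* if it is Scott-continuous and $F(a\cap b)=F(a)\cap F(b)$ for coherent cliques $a,b$. A *coherent representation* of a set $S$ is a partial surjection $\rho:\subseteq\mathbf X\to S$. A function $f:S\to T$ is *stably realizable* with respect to $\rho:\subseteq\mathbf X\to S$ and $\rho':\subseteq\mathbf Y\to T$ if there is a stable $F:\mathbf X\to\mathbf Y$ such that for all $a\in\mathrm{dom}(\rho)$, $F(a)\in\mathrm{dom}(\rho')$ and $\rho'(F(a))=f(\rho(a))$. $\mathbf{StabRep}$ is the category of coherent representations and stably realizable functions. $\mathbf{TTERep}$ is defined in the same way, with partial surjections from Baire space $\mathbb B=\mathbb N^{\mathbb N}$ as objects and functions tracked by partial continuous functions $\mathbb B\rightharpoonup\mathbb B$ as morphisms. *Kleene's second algebra* $\mathcal K_2$ is $\mathbb B$ with the partial application $(\alpha\cdot\beta)(n)=\alpha(\langle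 n,\beta(0),\dots,\beta(k-1)\rangle)-1$, where $k$ is least such that $\alpha(\langle n,\beta(0),\dots,\beta(k-1)\rangle)\neq0$; $\alpha\cdot\beta$ is defined iff such a $k$ exists for every $n$. A coherence space $\mathbf U$ is *universal* if every coherence space embeds into it by an injection of tokens preserving and reflecting coherence. Let $\mathbf U\Rightarrow\mathbf U$ be the coherence space $!\,\mathbf U\multimap\mathbf U$, whose cliques are the traces of stable maps $\mathbf U\to\mathbf U$. For universal $\mathbf U$ and an embedding $e:(\mathbf U\Rightarrow\mathbf U)\hookrightarrow\mathbf U$, let $\mathbb Coh_{\mathbf U,e}$ be the set of cliques of $\mathbf U$, where $a\cdot b$ is the value at $b$ of the stable map with trace $e^{-1}(a)$. An *applicative morphism* $\gamma:A\to B$ of partial combinatory algebras (PCAs) is a relation $\gamma\subseteq A\times B$ with every $\gamma(a)=\{b : (a,b)\in\gamma\}$ nonempty, for which some $r\in B$ satisfies: if $b\in\gamma(a)$, $b'\in\gamma(a')$ and $aa'$ is defined, then $rbb'$ is defined and lies in $\gamma(aa')$. Write $\gamma\preceq\gamma'$ if there is $t\in B$ such that for all $a$ and all $b\in\gamma(a)$,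 $tb$ is defined and lies in $\gamma'(a)$; write $\gamma\sim\gamma'$ if $\gamma\preceq\gamma'$ and $\gamma'\preceq\gamma$. **Theorem.** 1. $\mathbf{TTERep}$ is equivalent to a full coreflective subcategory of $\mathbf{StabRep}$. 2. $\mathcal K_2$ is a PCA, a universal coherence space exists, and for every universal $\mathbf U$ and every embedding $e:(\mathbf U\Rightarrow\mathbf U)\hookrightarrow\mathbf U$, $\mathbb Coh_{\mathbf U,e}$ is a PCA. Moreover there are applicative morphisms $\delta:\mathcal K_2\to\mathbb Coh_{\mathbf U,e}$ and $\gamma:\mathbb Coh_{\mathbf U,e}\to\mathcal K_2$ with $\gamma\circ\delta\sim\mathrm{id}$ and $\delta\circ\gamma\preceq\mathrm{id}$ (an applicative retraction) that yield (1): the sets $\delta(p)$ are pairwise disjoint, and sending $\rho:\subseteq\mathbb B\to S$ to the coherent representation $\subseteq\mathbf U\to S$ that maps each $a\in\delta(p)$, $p\in\mathrm{dom}(\rho)$, to $\rho(p)$, and every function to itself, is a well-defined functor $\mathbf{TTERep}\to\mathbf{StabRep}$ which is, up to natural isomorphism, an equivalence onto a full coreflective subcategory of $\mathbf{StabRep}$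 followed by the inclusion. -/

import Mathlib

open CategoryTheory

universe u v

/-! ## Coherence spaces and stable maps -/

/-- A coherence space: a countable set of tokens with a reflexive symmetric relation. -/
structure CohSpace : Type (v + 1) where
  /-- The tokens. -/
  Token : Type v
  /-- The coherence relation. -/
  coh : Token → Token → Prop
  countable_token : Countable Token
  refl : ∀ x, coh x x
  symm : ∀ x y, coh x y → coh y x

namespace CohSpace

/-- Cliques of `X`, ordered by inclusion. -/
def Clique (X : CohSpace.{v}) : Type v :=
  {a : Set X.Token // ∀ x ∈ a, ∀ y ∈ a, X.coh x y}

instance (X : CohSpace.{v}) : PartialOrder X.Clique :=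
  inferInstanceAs (PartialOrder {a : Set X.Token // ∀ x ∈ a, ∀ y ∈ a, X.coh x y})

/-- Coherence of cliques: every token of `a` is coherent with every token of `b`,
that is, `a ∪ b` is a clique. -/
def Clique.Coherent {X : CohSpace.{v}} (a b : X.Clique) : Prop :=
  ∀ x ∈ a.1, ∀ y ∈ b.1, X.coh x y

/-- The intersection of two cliques. -/
def Clique.inter {X : CohSpace.{v}} (a b : X.Clique) : X.Clique :=
  ⟨a.1 ∩ b.1, fun x hx y hy => a.2 x hx.1 y hy.1⟩

/-- The union of two coherent cliques. -/
def Clique.union {X : CohSpace.{v}} (a b : X.Clique) (h : a.Coherent b) : X.Clique :=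
  ⟨a.1 ∪ b.1, by
    rintro x (hx | hx) y (hy | hy)
    · exact a.2 x hx y hy
    · exact h x hx y hy
    · exact X.symm _ _ (h y hy x hx)
    · exact b.2 x hx y hy⟩

/-- A map between the sets of cliques is stable if it is Scott-continuous and preserves
intersections of coherent cliques. -/
def IsStable {X Y : CohSpace.{v}} (F : X.Clique → Y.Clique) : Prop :=
  ScottContinuous F ∧
    ∀ a b : X.Clique, a.Coherent b → F (a.inter b) = (F a).inter (F b)

theorem IsStable.id (X : CohSpace.{v}) : IsStable (fun a : X.Clique => a) :=
  ⟨ScottContinuous.id, fun _ _ _ => rfl⟩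

theorem IsStable.coherent {X Y : CohSpace.{v}} {F : X.Clique → Y.Clique} (hF : IsStable F)
    {a b : X.Clique} (h : a.Coherent b) : (F a).Coherent (F b) := by
  intro x hx y hy
  have hm : Monotone F := hF.1.monotone
  have h1 : a ≤ a.union b h := fun _ hz => Or.inl hz
  have h2 : b ≤ a.union b h := fun _ hz => Or.inr hz
  exact (F (a.union b h)).2 x (hm h1 hx) y (hm h2 hy)

theorem IsStable.comp {X Y Z : CohSpace.{v}} {G : Y.Clique → Z.Clique}
    {F : X.Clique → Y.Clique} (hG : IsStable G) (hF : IsStable F) :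
    IsStable (fun a => G (F a)) :=
  ⟨hF.1.comp hG.1, fun a b h => by
    show G (F (a.inter b)) = _
    rw [hF.2 a b h, hG.2 _ _ (hF.coherent h)]⟩

/-- The coherence space `!X`: its tokens are the finite cliques of `X`, and two of them
are coherent if they are coherent as cliques. -/
def bang (X : CohSpace.{v}) : CohSpace.{v} where
  Token := {a : Finset X.Token // ∀ x ∈ a, ∀ y ∈ a, X.coh x y}
  coh a b := ∀ x ∈ a.1, ∀ y ∈ b.1, X.coh x y
  countable_token := by
    have := X.countable_token
    infer_instance
  refl a := a.2
  symm _ _ h y hy x hx := X.symm _ _ (h x hx y hy)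

/-- The coherence space of linear maps: distinct tokens `(z, x)` and `(w, y)` are coherent
if coherence of `z` and `w` implies strict coherence of `x` and `y`. -/
def lolli (X Y : CohSpace.{v}) : CohSpace.{v} where
  Token := X.Token × Y.Token
  coh p q := p = q ∨ (X.coh p.1 q.1 → p.2 ≠ q.2 ∧ Y.coh p.2 q.2)
  countable_token := by
    have := X.countable_token
    have := Y.countable_token
    infer_instance
  refl p := Or.inl rfl
  symm p q h := by
    rcases h with h | h
    · exact Or.inl h.symm
    · exact Or.inr fun h' =>
        ⟨(h (X.symm _ _ h')).1.symm, Y.symm _ _ (h (X.symm _ _ h')).2⟩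

/-- The coherence space of stable maps, `!X ⊸ Y`. Its cliques are the traces of
the stable maps from `X` to `Y`. -/
def stableHom (X Y : CohSpace.{v}) : CohSpace.{v} :=
  lolli (bang X) Y

/-- The stable map with trace `κ`, applied to the clique `a`. -/
def evalTrace {X Y : CohSpace.{v}} (κ : (stableHom X Y).Clique) (a : X.Clique) : Y.Clique :=
  ⟨{y | ∃ a₀ : (bang X).Token, (∀ x ∈ a₀.1, x ∈ a.1) ∧ ((a₀, y) : (stableHom X Y).Token) ∈ κ.1},
    by
      rintro y ⟨a₀, ha, hy⟩ z ⟨b₀, hb, hz⟩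
      rcases κ.2 _ hy _ hz with h | h
      · obtain rfl : y = z := congrArg Prod.snd h
        exact Y.refl _
      · exact (h fun x hx x' hx' => a.2 x (ha x hx) x' (hb x' hx')).2⟩

/-- The preimage of a clique under an embedding of coherence spaces (an injection of tokens
that preserves and reflects coherence). -/
def Clique.pullback {X Y : CohSpace.{v}} (e : X.coh ↪r Y.coh) (a : Y.Clique) : X.Clique :=
  ⟨{x | e x ∈ a.1}, fun _ hx _ hy => e.map_rel_iff.1 (a.2 _ hx _ hy)⟩

/-- A coherence space is universal if every coherence space embeds into it. -/
def IsUniversal (U : CohSpace.{v}) : Prop :=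
  ∀ X : CohSpace.{v}, Nonempty (X.coh ↪r U.coh)

end CohSpace

/-! ## Coherent representations -/

/-- A coherent representation: a partial surjection from the cliques of a coherence space
onto a set. -/
structure StabRep : Type (max (u + 1) (v + 1)) where
  /-- The represented set. -/
  carrier : Type u
  /-- The representing coherence space. -/
  space : CohSpace.{v}
  /-- The representation. -/
  rep : space.Clique →. carrier
  surj : ∀ s, ∃ a, s ∈ rep a

/-- `f` is stably realizable: it is tracked by a stable map. -/
def StablyRealizable (A B : StabRep.{u, v}) (f : A.carrier → B.carrier) : Prop :=
  ∃ F : A.space.Clique → B.space.Clique, CohSpace.IsStable F ∧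
    ∀ a s, s ∈ A.rep a → f s ∈ B.rep (F a)

/-- The category of coherent representations and stably realizable functions. -/
instance : Category.{u} StabRep.{u, v} where
  Hom A B := {f : A.carrier → B.carrier // StablyRealizable A B f}
  id A := ⟨fun s => s, fun a => a, CohSpace.IsStable.id _, fun _ _ h => h⟩
  comp f g := ⟨fun s => g.1 (f.1 s), by
    obtain ⟨F, hF, hf⟩ := f.2
    obtain ⟨G, hG, hg⟩ := g.2
    exact ⟨fun a => G (F a), hG.comp hF, fun a s h => hg _ _ (hf a s h)⟩⟩

/-! ## Baire-space representations -/

/-- Baire space, with the product topology. -/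
abbrev Baire : Type := ℕ → ℕ

/-- A Baire-space representation: a partial surjection from Baire space onto a set. -/
structure TTERep : Type (u + 1) where
  /-- The represented set. -/
  carrier : Type u
  /-- The representation. -/
  rep : Baire →. carrier
  surj : ∀ s, ∃ p, s ∈ rep p

/-- `f` is continuously realizable: it is tracked by a partial continuous function on
Baire space, given by its domain `D` and its values `F` there. -/
def ContinuouslyRealizable (A B : TTERep.{u}) (f : A.carrier → B.carrier) : Prop :=
  ∃ (D : Set Baire) (F : Baire → Baire), ContinuousOn F D ∧
    ∀ p s, s ∈ A.rep p → p ∈ D ∧ f s ∈ B.rep (F p)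

/-- The category of Baire-space representations and continuously realizable functions. -/
instance : Category.{u} TTERep.{u} where
  Hom A B := {f : A.carrier → B.carrier // ContinuouslyRealizable A B f}
  id A := ⟨fun s => s, Set.univ, fun p => p, continuousOn_id,
    fun _ _ h => ⟨Set.mem_univ _, h⟩⟩
  comp f g := ⟨fun s => g.1 (f.1 s), by
    obtain ⟨D, F, hF, hf⟩ := f.2
    obtain ⟨E, G, hG, hg⟩ := g.2
    refine ⟨D ∩ F ⁻¹' E, fun p => G (F p), ?_, fun p s h => ?_⟩
    · exact hG.comp (hF.mono Set.inter_subset_left) fun p hp => hp.2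
    · have h1 := hf p s h
      have h2 := hg _ _ h1.2
      exact ⟨⟨h1.1, h2.1⟩, h2.2⟩⟩

/-! ## Partial combinatory algebras and applicative morphisms -/

/-- A set with a partial binary application. -/
structure PartialApp : Type (u + 1) where
  /-- The underlying set. -/
  carrier : Type u
  /-- The application. -/
  app : carrier → carrier → Part carrier

namespace PartialApp

/-- `f · a · b`, with application associated to the left. -/
def app₂ (A : PartialApp.{u}) (f a b : A.carrier) : Part A.carrier :=
  (A.app f a).bind fun g => A.app g b

/-- `f · a · b · c`, with application associated to the left. -/
def app₃ (A : PartialApp.{u}) (f a b c : A.carrier) : Part A.carrier :=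
  (A.app₂ f a b).bind fun g => A.app g c

/-- `A` is a partial combinatory algebra: it has `k` and `s` with `k a b = a`, `s a b`
defined, and `s a b c ≃ (a c) (b c)` (Kleene equality). -/
def IsPCA (A : PartialApp.{u}) : Prop :=
  ∃ k s : A.carrier,
    (∀ a b, A.app₂ k a b = Part.some a) ∧
    (∀ a b, (A.app₂ s a b).Dom) ∧
    (∀ a b c, A.app₃ s a b c =
      (A.app a c).bind fun x => (A.app b c).bind fun y => A.app x y)

/-- An applicative morphism from `A` to `B`: a total relation such that the application of
`A` is realized by an element `r` of `B`. -/
def IsApplicativeMorphism (A : PartialApp.{u}) (B : PartialApp.{v})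
    (γ : A.carrier → B.carrier → Prop) : Prop :=
  (∀ a, ∃ b, γ a b) ∧
  ∃ r : B.carrier, ∀ a a' c b b', γ a b → γ a' b' → c ∈ A.app a a' →
    ∃ d ∈ B.app₂ r b b', γ c d

/-- The preorder on applicative morphisms from `A` to `B`: some element of `B` translates
`γ` into `γ'`. -/
def Translates (A : PartialApp.{u}) (B : PartialApp.{v})
    (γ γ' : A.carrier → B.carrier → Prop) : Prop :=
  ∃ t : B.carrier, ∀ a b, γ a b → ∃ d ∈ B.app t b, γ' a d

/-- `δ` and `γ` are an applicative retraction of `B` onto `A`: applicative morphisms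
`δ : A → B` and `γ : B → A` with `γ ∘ δ ∼ id` and `δ ∘ γ ≼ id`. -/
def IsApplicativeRetraction (A : PartialApp.{u}) (B : PartialApp.{v})
    (δ : A.carrier → B.carrier → Prop) (γ : B.carrier → A.carrier → Prop) : Prop :=
  A.IsApplicativeMorphism B δ ∧ B.IsApplicativeMorphism A γ ∧
  A.Translates A (Relation.Comp δ γ) Eq ∧ A.Translates A Eq (Relation.Comp δ γ) ∧
  B.Translates B (Relation.Comp γ δ) Eq

end PartialApp

/-- The code of the finite sequence `n, β 0, …, β (k - 1)`. -/
def kleeneCode (β : Baire) (n k : ℕ) : ℕ :=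
  Encodable.encode (n :: (List.range k).map β)

/-- Kleene's second algebra: `(α · β) n` is `α ⟨n, β 0, …, β (k - 1)⟩ - 1` for the least `k`
for which `α ⟨n, β 0, …, β (k - 1)⟩` is not zero, and `α · β` is defined if such a `k`
exists for every `n`. -/
def kleeneSecond : PartialApp.{0} where
  carrier := Baire
  app α β :=
    ⟨∀ n, ∃ k, α (kleeneCode β n k) ≠ 0,
      fun h n => α (kleeneCode β n (Nat.find (h n))) - 1⟩

/-- The combinatory algebra of the cliques of `U`, for a coherence space `U` with an
embedding `e` of its space of stable endomaps: `a · b` is the value at `b` of the stable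
map whose trace is coded by `a`. -/
def cohAlgebra (U : CohSpace.{v}) (e : (U.stableHom U).coh ↪r U.coh) : PartialApp.{v} where
  carrier := U.Clique
  app a b := Part.some (CohSpace.evalTrace (CohSpace.Clique.pullback e a) b)

/-! ## The functor induced by an applicative morphism -/

/-- A relation is discrete if related sets of distinct elements are disjoint. -/
def IsDiscreteRel {α : Type u} {β : Type v} (δ : α → β → Prop) : Prop :=
  ∀ p q a, δ p a → δ q a → p = q

/-- The representation of `A.carrier` over `U` induced by a Baire-space representation `A`
and a relation `δ`: `a` represents `s` if `a` is related to a name of `s`. The choice is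
immaterial when `δ` is discrete. -/
noncomputable def inducedPFun {U : CohSpace.{v}} (δ : Baire → U.Clique → Prop)
    (A : TTERep.{u}) : U.Clique →. A.carrier :=
  fun a => ⟨∃ s, ∃ p, δ p a ∧ s ∈ A.rep p, fun h => h.choose⟩

theorem mem_inducedPFun {U : CohSpace.{v}} {δ : Baire → U.Clique → Prop}
    (hd : IsDiscreteRel δ) (A : TTERep.{u}) (a : U.Clique) (s : A.carrier) :
    s ∈ inducedPFun δ A a ↔ ∃ p, δ p a ∧ s ∈ A.rep p := by
  constructor
  · rintro ⟨h, rfl⟩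
    exact Exists.choose_spec h
  · rintro ⟨p, ha, hp⟩
    have h : ∃ s, ∃ p, δ p a ∧ s ∈ A.rep p := ⟨s, p, ha, hp⟩
    refine ⟨h, ?_⟩
    obtain ⟨q, hq, hs⟩ := h.choose_spec
    obtain rfl := hd p q a ha hq
    exact Part.mem_unique hs hp

/-- The coherent representation over `U` induced by a Baire-space representation `A`
and a total discrete relation `δ`. -/
noncomputable def inducedRep {U : CohSpace.{v}} (δ : Baire → U.Clique → Prop)
    (ht : ∀ p, ∃ a, δ p a) (hd : IsDiscreteRel δ) (A : TTERep.{u}) : StabRep.{u, v} where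
  carrier := A.carrier
  space := U
  rep := inducedPFun δ A
  surj s := by
    obtain ⟨p, hp⟩ := A.surj s
    obtain ⟨a, ha⟩ := ht p
    exact ⟨a, (mem_inducedPFun hd A a s).2 ⟨p, ha, hp⟩⟩

/-- The functor from `TTERep` to `StabRep` induced by `δ`: it leaves the represented sets
and the functions between them unchanged. -/
noncomputable def inducedRepFunctor {U : CohSpace.{v}} (δ : Baire → U.Clique → Prop)
    (ht : ∀ p, ∃ a, δ p a) (hd : IsDiscreteRel δ)
    (hr : ∀ (A B : TTERep.{u}) (f : A.carrier → B.carrier), ContinuouslyRealizable A B f →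
      StablyRealizable (inducedRep δ ht hd A) (inducedRep δ ht hd B) f) :
    TTERep.{u} ⥤ StabRep.{u, v} where
  obj A := inducedRep δ ht hd A
  map {A B} f := ⟨f.1, hr A B f.1 f.2⟩

/-! ## Baire space -/

namespace Baire

open PiNat

/-! The cliques of `baireSpace` are the partial functions on the natural numbers. An embedding `i`
of it into `U` gives the morphism from Baire space: a sequence is named by the image of its graph,
`name i p`. The morphism back relates a clique to all sequences that enumerate its tokens
(`Enumerates`). Everything rests on passing between continuous and stable maps along these two
relations.

From continuous to stable: a partial continuous function is application of some element of Kleene's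
second algebra (`exists_kleene_code_of_continuousOn`). This application reads its arguments
sequentially and deterministically, so it extends to a stable operation on partial functions
(`IsStable.kleeneClique`). Recovering a clique from an enumeration is stable as well, once only
first occurrences count (`IsStable.listedClique`).

From stable to continuous: a token of a value depends on finitely many tokens of the argument, which
is an open condition, so the value at a name can be enumerated continuously
(`IsStable.exists_continuous_enumerates`). A sequence can be decoded continuously from any
enumeration of its name (`exists_continuousOn_decoding`).

Hence a function out of `nameRep i A` into `X` is stably realizable exactly when it is continuously
realizable into `X.enumRep` (`stablyRealizable_nameRep_iff`). This is an adjunction that leaves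
functions unchanged; decoding makes the left adjoint full, and its essential image is the
coreflective subcategory. The PCA laws come from coding with a continuous parameter
(`exists_kleene_code_param`) on one side and from currying stable maps (`IsStable.curry`) on the
other. -/

theorem isOpen_iff_cylinder {V : Set Baire} :
    IsOpen V ↔ ∀ p ∈ V, ∃ k, ∀ q, (∀ j < k, q j = p j) → q ∈ V := by
  constructor
  · intro hV p hp
    obtain ⟨_, ⟨x, k, rfl⟩, hpx, hx⟩ :=
      (isTopologicalBasis_cylinders (fun _ => ℕ)).exists_subset_of_mem_open hp hV
    exact ⟨k, fun q hq => hx fun j hj => (hq j hj).trans (hpx j hj)⟩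
  · intro h
    refine isOpen_iff_forall_mem_open.2 fun p hp => ?_
    obtain ⟨k, hk⟩ := h p hp
    exact ⟨cylinder p k, fun q hq => hk q hq, isOpen_cylinder _ _ _, self_mem_cylinder _ _⟩

theorem isOpen_prod_iff_cylinder {V : Set (Baire × Baire)} (hV : IsOpen V) {p q : Baire}
    (h : (p, q) ∈ V) : ∃ k, ∀ p' q' : Baire, (∀ j < k, p' j = p j) → (∀ j < k, q' j = q j) →
      (p', q') ∈ V := by
  obtain ⟨A, B, hA, hB, hp, hq, hAB⟩ := isOpen_prod_iff.1 hV p q h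
  obtain ⟨k, hk⟩ := isOpen_iff_cylinder.1 hA p hp
  obtain ⟨l, hl⟩ := isOpen_iff_cylinder.1 hB q hq
  exact ⟨max k l, fun p' q' hp' hq' => hAB
    ⟨hk _ fun j hj => hp' j (lt_max_of_lt_left hj), hl _ fun j hj => hq' j (lt_max_of_lt_right hj)⟩⟩

theorem continuous_of_finite_dependence {f : Baire → ℕ} (k : ℕ)
    (h : ∀ p q : Baire, (∀ j < k, q j = p j) → f q = f p) : Continuous f := by
  refine continuous_def.2 fun s _ => isOpen_iff_cylinder.2 fun p hp => ⟨k, fun q hq => ?_⟩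
  rw [Set.mem_preimage, h p q hq]
  exact hp

theorem continuousOn_iff {F : Baire → Baire} {D : Set Baire} :
    ContinuousOn F D ↔
      ∀ p ∈ D, ∀ n, ∃ k, ∀ q ∈ D, (∀ j < k, q j = p j) → F q n = F p n := by
  rw [continuousOn_pi]
  constructor
  · intro h p hp n
    obtain ⟨V, hV, hpV, hVD⟩ := mem_nhdsWithin.1
      (h n p hp (IsOpen.mem_nhds (isOpen_discrete {F p n}) rfl))
    obtain ⟨k, hk⟩ := isOpen_iff_cylinder.1 hV p hpV
    exact ⟨k, fun q hq hqp => hVD ⟨hk q hqp, hq⟩⟩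
  · intro h n p hp
    obtain ⟨k, hk⟩ := h p hp n
    refine (continuousWithinAt_const (b := F p n)).congr_of_eventuallyEq ?_ rfl
    exact mem_nhdsWithin.2 ⟨cylinder p k, isOpen_cylinder _ _ _, self_mem_cylinder _ _,
      fun q hq => hk q hq.2 hq.1⟩

/-- The coordinatewise pairing of two sequences. -/
def pair (p q : Baire) : Baire := fun n => Nat.pair (p n) (q n)

/-- The first component of a paired sequence. -/
def left (p : Baire) : Baire := fun n => (p n).unpair.1

/-- The second component of a paired sequence. -/
def right (p : Baire) : Baire := fun n => (p n).unpair.2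

@[simp] theorem left_pair (p q : Baire) : left (pair p q) = p := by
  funext n; simp [left, pair]

@[simp] theorem right_pair (p q : Baire) : right (pair p q) = q := by
  funext n; simp [right, pair]

theorem continuous_left : Continuous left :=
  continuous_pi fun n => (continuous_of_discreteTopology (f := fun m : ℕ => m.unpair.1)).comp
    (continuous_apply n)

theorem continuous_right : Continuous right :=
  continuous_pi fun n => (continuous_of_discreteTopology (f := fun m : ℕ => m.unpair.2)).comp
    (continuous_apply n)

theorem continuous_pair : Continuous fun x : Baire × Baire => pair x.1 x.2 :=
  continuous_pi fun n =>
    (continuous_of_discreteTopology (f := fun m : ℕ × ℕ => Nat.pair m.1 m.2)).comp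
      (g := fun m : ℕ × ℕ => Nat.pair m.1 m.2) (f := fun x : Baire × Baire => (x.1 n, x.2 n))
      (((continuous_apply n).comp continuous_fst).prodMk
        ((continuous_apply n).comp continuous_snd))

theorem isOpen_apply_eq {X : Type*} [TopologicalSpace X] {f : X → Baire} (hf : Continuous f)
    (n m : ℕ) : IsOpen {x | f x n = m} :=
  (isOpen_discrete {m}).preimage ((continuous_apply n).comp hf)

/-- Sets of natural numbers that depend on a sequence in an open way can be enumerated
continuously. -/
theorem exists_continuous_enumeration (Φ : Baire → ℕ → Prop) (hΦ : ∀ y, IsOpen {p | Φ p y}) :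
    ∃ G : Baire → Baire, Continuous G ∧ ∀ p y, Φ p y ↔ ∃ n, G p n = y + 1 := by
  classical
  -- The index codes a candidate `y` and a length: `y` is listed when the cylinder of that length
  -- around `p` already lies in `Φ · y`. The value 0 lists nothing, hence the shift by one.
  refine ⟨fun p n => if ∀ q : Baire, (∀ j < n.unpair.2, q j = p j) → Φ q n.unpair.1
    then n.unpair.1 + 1 else 0, continuous_pi fun n =>
      continuous_of_finite_dependence n.unpair.2 fun p q hpq => ?_, fun p y => ⟨fun h => ?_, ?_⟩⟩
  · refine if_congr (forall_congr' fun r => ?_) rfl rfl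
    refine imp_congr_left (forall₂_congr fun j hj => ?_)
    rw [hpq j hj]
  · obtain ⟨k, hk⟩ := isOpen_iff_cylinder.1 (hΦ y) p h
    exact ⟨Nat.pair y k, by simpa using hk⟩
  · rintro ⟨n, hn⟩
    dsimp only at hn
    split_ifs at hn with h
    obtain rfl : n.unpair.1 = y := by omega
    exact h p fun _ _ => rfl

end Baire

/-! ## Kleene's second algebra -/

theorem kleeneCode_congr {β β' : Baire} (n : ℕ) {k : ℕ} (h : ∀ j < k, β j = β' j) :
    kleeneCode β n k = kleeneCode β' n k := by
  unfold kleeneCode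
  congr 2
  exact List.map_congr_left fun j hj => h j (List.mem_range.1 hj)

theorem kleeneCode_inj {β β' : Baire} {n n' k k' : ℕ}
    (h : kleeneCode β n k = kleeneCode β' n' k') :
    n = n' ∧ k = k' ∧ ∀ j < k, β j = β' j := by
  have h := Encodable.encode_injective h
  rw [List.cons.injEq] at h
  obtain ⟨hn, h⟩ := h
  obtain rfl : k = k' := by simpa using congrArg List.length h
  refine ⟨hn, rfl, fun j hj => ?_⟩
  exact List.map_inj_left.1 h j (List.mem_range.2 hj)

/-- The application of Kleene's second algebra, as an operation on Baire space. -/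
def kleeneApp (α β : Baire) : Part Baire :=
  kleeneSecond.app α β

theorem mem_kleeneApp {α β d : Baire} :
    d ∈ kleeneApp α β ↔ ∀ n, ∃ k, α (kleeneCode β n k) = d n + 1 ∧
      ∀ j < k, α (kleeneCode β n j) = 0 := by
  constructor
  · rintro ⟨h, rfl⟩ n
    refine ⟨Nat.find (h n), ?_, fun j hj => not_not.1 (Nat.find_min (h n) hj)⟩
    exact (Nat.sub_add_cancel (Nat.one_le_iff_ne_zero.2 (Nat.find_spec (h n)))).symm
  · intro h
    have h' : ∀ n, ∃ k, α (kleeneCode β n k) ≠ 0 := fun n => by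
      obtain ⟨k, hk, -⟩ := h n
      exact ⟨k, by omega⟩
    refine ⟨h', funext fun n => ?_⟩
    obtain ⟨k, hk, hj⟩ := h n
    have hf : Nat.find (h' n) = k :=
      (Nat.find_eq_iff (h' n)).2 ⟨by omega, fun j hjk => not_not.2 (hj j hjk)⟩
    show α (kleeneCode β n (Nat.find (h' n))) - 1 = d n
    rw [hf, hk, Nat.add_sub_cancel]

/-- A partial function with an open graph in every coordinate is represented in Kleene's
second algebra, continuously in a parameter. -/
theorem exists_kleene_code_param (H : Baire → Baire → ℕ → ℕ → Prop)
    (hopen : ∀ n m, IsOpen {x : Baire × Baire | H x.1 x.2 n m})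
    (hfun : ∀ p r n m m', H p r n m → H p r n m' → m = m') :
    ∃ c : Baire → Baire, Continuous c ∧
      ∀ p r d, d ∈ kleeneApp (c p) r ↔ ∀ n, H p r n (d n) := by
  classical
  -- The same length `k` bounds what is read of the parameter and of the argument. So at a code of
  -- length `k` the value of `c` depends on `k` entries of `p` only, which makes `c` continuous.
  let Q : Baire → ℕ → ℕ → Prop := fun p z m => ∃ n r k, z = kleeneCode r n k ∧
    ∀ p' r' : Baire, (∀ j < k, p' j = p j) → (∀ j < k, r' j = r j) → H p' r' n m
  let c : Baire → Baire := fun p z => if h : ∃ m, Q p z m then h.choose + 1 else 0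
  have hQ : ∀ p r n k m, Q p (kleeneCode r n k) m →
      ∀ p' r' : Baire, (∀ j < k, p' j = p j) → (∀ j < k, r' j = r j) → H p' r' n m := by
    rintro p r n k m ⟨n', r', k', hz, h⟩ p' r'' hp hr
    obtain ⟨rfl, rfl, hj⟩ := kleeneCode_inj hz
    exact h p' r'' hp fun j h => (hr j h).trans (hj j h)
  have hc : ∀ p r n k m, c p (kleeneCode r n k) = m + 1 → H p r n m := by
    intro p r n k m h
    dsimp only [c] at h
    split_ifs at h with h'
    obtain rfl : h'.choose = m := by omega
    exact hQ _ _ _ _ _ h'.choose_spec p r (fun _ _ => rfl) fun _ _ => rfl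
  refine ⟨c, continuous_pi fun z => ?_, fun p r d => ?_⟩
  · by_cases hz : ∃ n r k, z = kleeneCode r n k
    · obtain ⟨n, r, k, rfl⟩ := hz
      refine Baire.continuous_of_finite_dependence k fun p q hpq => ?_
      have : Q q (kleeneCode r n k) = Q p (kleeneCode r n k) := by
        funext m
        refine propext ⟨fun h => ⟨n, r, k, rfl, fun p' r' hp hr => ?_⟩,
          fun h => ⟨n, r, k, rfl, fun p' r' hp hr => ?_⟩⟩
        · exact hQ q r n k m h p' r' (fun j hj => (hp j hj).trans (hpq j hj).symm) hr
        · exact hQ p r n k m h p' r' (fun j hj => (hp j hj).trans (hpq j hj)) hr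
      simp only [c, this]
    · have : ∀ p, c p z = 0 := fun p => dif_neg fun ⟨m, n, r, k, h, _⟩ => hz ⟨n, r, k, h⟩
      simpa only [this] using continuous_const
  · rw [mem_kleeneApp]
    constructor
    · intro h n
      obtain ⟨k, hk, -⟩ := h n
      exact hc p r n k _ hk
    · intro h n
      have hex : ∃ k, c p (kleeneCode r n k) ≠ 0 := by
        obtain ⟨k, hk⟩ := Baire.isOpen_prod_iff_cylinder (hopen n (d n)) (h n)
        refine ⟨k, ?_⟩
        have : ∃ m, Q p (kleeneCode r n k) m := ⟨d n, n, r, k, rfl, hk⟩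
        simp only [c, dif_pos this]
        omega
      refine ⟨Nat.find hex, ?_, fun j hj => not_not.1 (Nat.find_min hex hj)⟩
      obtain ⟨m, hm⟩ := Nat.exists_eq_succ_of_ne_zero (Nat.find_spec hex)
      -- The least successful prefix need not be the one found above, but single-valuedness forces
      -- the same output.
      rw [hm, hfun p r n m (d n) (hc p r n _ m hm) (h n)]

theorem exists_kleene_code (H : Baire → ℕ → ℕ → Prop)
    (hopen : ∀ n m, IsOpen {p | H p n m})
    (hfun : ∀ p n m m', H p n m → H p n m' → m = m') :
    ∃ α : Baire, ∀ p d, d ∈ kleeneApp α p ↔ ∀ n, H p n (d n) := by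
  obtain ⟨c, -, hc⟩ := exists_kleene_code_param (fun _ => H)
    (fun n m => (hopen n m).preimage continuous_snd) fun _ => hfun
  exact ⟨c 0, hc 0⟩

theorem exists_kleene_code_of_continuousOn {D : Set Baire} {G : Baire → Baire}
    (hG : ContinuousOn G D) : ∃ α : Baire, ∀ p ∈ D, G p ∈ kleeneApp α p := by
  -- Some prefix of `p` determines the output on `D`. The prefix must be met by `D`, or every output
  -- would qualify vacuously; for two prefixes, the point of `D` on the longer one also lies on the
  -- shorter one, which gives uniqueness.
  let H : Baire → ℕ → ℕ → Prop := fun p n m =>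
    ∃ k, (∃ q ∈ D, ∀ j < k, q j = p j) ∧ ∀ q ∈ D, (∀ j < k, q j = p j) → G q n = m
  have hopen : ∀ n m, IsOpen {p | H p n m} := by
    refine fun n m => Baire.isOpen_iff_cylinder.2 ?_
    rintro p ⟨k, ⟨q, hq, hqp⟩, h⟩
    exact ⟨k, fun p' hp' => ⟨k, ⟨q, hq, fun j hj => (hqp j hj).trans (hp' j hj).symm⟩,
      fun q' hq' hqp' => h q' hq' fun j hj => (hqp' j hj).trans (hp' j hj)⟩⟩
  have hfun : ∀ p n m m', H p n m → H p n m' → m = m' := by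
    rintro p n m m' ⟨k, ⟨q, hq, hqp⟩, h⟩ ⟨k', ⟨q', hq', hqp'⟩, h'⟩
    rcases le_total k k' with hk | hk
    · rw [← h q' hq' fun j hj => hqp' j (hj.trans_le hk), h' q' hq' hqp']
    · rw [← h' q hq fun j hj => hqp j (hj.trans_le hk), h q hq hqp]
  obtain ⟨α, hα⟩ := exists_kleene_code H hopen hfun
  refine ⟨α, fun p hp => (hα p _).2 fun n => ?_⟩
  obtain ⟨k, hk⟩ := Baire.continuousOn_iff.1 hG p hp n
  exact ⟨k, ⟨p, hp, fun _ _ => rfl⟩, hk⟩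

theorem exists_kleene_code_of_continuous {G : Baire → Baire} (hG : Continuous G) :
    ∃ α : Baire, ∀ p, kleeneApp α p = Part.some (G p) := by
  obtain ⟨α, hα⟩ := exists_kleene_code_of_continuousOn hG.continuousOn (D := Set.univ)
  exact ⟨α, fun p => Part.eq_some_iff.2 (hα p trivial)⟩

theorem exists_kleene_code_of_continuous₂ {G : Baire → Baire → Baire}
    (hG : Continuous fun x : Baire × Baire => G x.1 x.2) :
    ∃ r : Baire, ∀ p q, (kleeneApp r p).bind (fun f => kleeneApp f q) = Part.some (G p q) := by
  obtain ⟨c, hc, hcG⟩ := exists_kleene_code_param (fun p q n m => G p q n = m)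
    (Baire.isOpen_apply_eq hG) (fun p r n m m' h h' => h.symm.trans h')
  obtain ⟨r, hr⟩ := exists_kleene_code_of_continuous hc
  refine ⟨r, fun p q => ?_⟩
  rw [hr, Part.bind_some]
  exact (Part.eq_some_iff.2 ((hcG _ _ _).2 fun _ => rfl))

/-- The graph of the `n`-th coordinate of the application of Kleene's second algebra. -/
def KleeneGraph (α β : Baire) (n m : ℕ) : Prop :=
  ∃ k, α (kleeneCode β n k) = m + 1 ∧ ∀ j < k, α (kleeneCode β n j) = 0

theorem KleeneGraph.unique {α β : Baire} {n m m' : ℕ} (h : KleeneGraph α β n m)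
    (h' : KleeneGraph α β n m') : m = m' := by
  obtain ⟨k, hk, hj⟩ := h
  obtain ⟨k', hk', hj'⟩ := h'
  rcases lt_trichotomy k k' with h | rfl | h
  · have := hj' k h; omega
  · omega
  · have := hj k' h; omega

/-- A computation of one output reads finitely many entries of both sequences. -/
theorem isOpen_kleeneGraph (n m : ℕ) :
    IsOpen {x : Baire × Baire | KleeneGraph x.1 x.2 n m} := by
  rw [isOpen_iff_mem_nhds]
  rintro ⟨α, β⟩ ⟨k, hk, hj⟩
  have h1 : ∀ᶠ x : Baire × Baire in nhds (α, β), ∀ j < k, x.2 j = β j :=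
    (Set.finite_Iio k).eventually_all.2 fun j _ =>
      (Baire.isOpen_apply_eq continuous_snd j (β j)).mem_nhds rfl
  have h2 : ∀ᶠ x : Baire × Baire in nhds (α, β), x.1 (kleeneCode β n k) = m + 1 :=
    (Baire.isOpen_apply_eq continuous_fst _ _).mem_nhds hk
  have h3 : ∀ᶠ x : Baire × Baire in nhds (α, β), ∀ j < k, x.1 (kleeneCode β n j) = 0 :=
    (Set.finite_Iio k).eventually_all.2 fun j hjk =>
      (Baire.isOpen_apply_eq continuous_fst _ _).mem_nhds (hj j hjk)
  filter_upwards [h1, h2, h3] with x h1 h2 h3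
  refine ⟨k, ?_, fun j hjk => ?_⟩
  · rw [kleeneCode_congr n h1, h2]
  · rw [kleeneCode_congr n fun i hi => h1 i (hi.trans hjk), h3 j hjk]

/-- The graph of the `n`-th coordinate of `r ↦ (p · r) · (q · r)`, where `p · r` and `q · r`
are required to be defined at `n`. -/
def KleeneGraph₂ (p q r : Baire) (n m : ℕ) : Prop :=
  (∃ u, KleeneGraph p r n u) ∧ (∃ w, KleeneGraph q r n w) ∧
    ∃ (k : ℕ) (w : Baire), (∀ j < k, KleeneGraph q r j (w j)) ∧
      KleeneGraph p r (kleeneCode w n k) (m + 1) ∧ ∀ j < k, KleeneGraph p r (kleeneCode w n j) 0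

theorem KleeneGraph₂.unique {p q r : Baire} {n m m' : ℕ} (h : KleeneGraph₂ p q r n m)
    (h' : KleeneGraph₂ p q r n m') : m = m' := by
  obtain ⟨-, -, k, w, hw, hk, hj⟩ := h
  obtain ⟨-, -, k', w', hw', hk', hj'⟩ := h'
  rcases lt_trichotomy k k' with h | rfl | h
  · have := hj' k h
    rw [← kleeneCode_congr n fun j hj => (hw j hj).unique (hw' j (hj.trans h))] at this
    exact absurd (hk.unique this) (by omega)
  · rw [← kleeneCode_congr n fun j hj => (hw j hj).unique (hw' j hj)] at hk'
    exact Nat.succ_injective (hk.unique hk')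
  · have := hj k' h
    rw [kleeneCode_congr n fun j hj => (hw j (hj.trans h)).unique (hw' j hj)] at this
    exact absurd (hk'.unique this) (by omega)

theorem isOpen_kleeneGraph₂ (n m : ℕ) :
    IsOpen {x : Baire × Baire × Baire | KleeneGraph₂ x.1 x.2.1 x.2.2 n m} := by
  have hp : ∀ n m, IsOpen {x : Baire × Baire × Baire | KleeneGraph x.1 x.2.2 n m} := fun n m =>
    (isOpen_kleeneGraph n m).preimage
      (continuous_fst.prodMk (continuous_snd.comp continuous_snd))
  have hq : ∀ n m, IsOpen {x : Baire × Baire × Baire | KleeneGraph x.2.1 x.2.2 n m} :=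
    fun n m => (isOpen_kleeneGraph n m).preimage
      ((continuous_fst.comp continuous_snd).prodMk (continuous_snd.comp continuous_snd))
  refine IsOpen.and ?_ (IsOpen.and ?_ ?_)
  · simp only [Set.ofPred_exists]
    exact isOpen_iUnion fun u => hp n u
  · simp only [Set.ofPred_exists]
    exact isOpen_iUnion fun u => hq n u
  · simp only [Set.ofPred_exists]
    refine isOpen_iUnion fun k => isOpen_iUnion fun w => IsOpen.and ?_ (IsOpen.and (hp _ _) ?_)
    · simp only [Set.ofPred_forall]
      exact (Set.finite_Iio k).isOpen_biInter fun j _ => hq _ _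
    · simp only [Set.ofPred_forall]
      exact (Set.finite_Iio k).isOpen_biInter fun j _ => hp _ _

/-- The computation itself reads only parts of `p · r` and `q · r`, while Kleene equality needs both
to be total. The two definedness clauses at `n` supply this when `n` varies. -/
theorem forall_kleeneGraph₂_iff {p q r d : Baire} :
    (∀ n, KleeneGraph₂ p q r n (d n)) ↔
      d ∈ (kleeneApp p r).bind fun x => (kleeneApp q r).bind fun y =>
        kleeneApp x y := by
  simp only [Part.mem_bind_iff]
  constructor
  · intro h
    choose x hx using fun n => (h n).1
    choose y hy using fun n => (h n).2.1
    refine ⟨x, mem_kleeneApp.2 hx, y, mem_kleeneApp.2 hy,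
      mem_kleeneApp.2 fun n => ?_⟩
    obtain ⟨-, -, k, w, hw, hk, hj⟩ := h n
    have hyw : ∀ j < k, y j = w j := fun j hj => (hy j).unique (hw j hj)
    refine ⟨k, ?_, fun j hjk => ?_⟩
    · rw [kleeneCode_congr n hyw]
      exact (hx _).unique hk
    · rw [kleeneCode_congr n fun i hi => hyw i (hi.trans hjk)]
      exact (hx _).unique (hj j hjk)
  · rintro ⟨x, hx, y, hy, hd⟩ n
    rw [mem_kleeneApp] at hx hy hd
    obtain ⟨k, hk, hj⟩ := hd n
    refine ⟨⟨_, hx n⟩, ⟨_, hy n⟩, k, y, fun j _ => hy j, ?_, fun j hjk => ?_⟩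
    · rw [← hk]
      exact hx _
    · rw [← hj j hjk]
      exact hx _

/-- For `s`, the code of `r ↦ (p · r) · (q · r)` is a total continuous function of the pair, so `s p
q` is always defined. Kleene equality holds because the code is defined only where the graph is
total. -/
theorem kleeneSecond_isPCA : kleeneSecond.IsPCA := by
  obtain ⟨k, hk⟩ := exists_kleene_code_of_continuous₂ (G := fun p _ => p) continuous_fst
  obtain ⟨c, hc, hcs⟩ := exists_kleene_code_param
    (fun x r => KleeneGraph₂ (Baire.left x) (Baire.right x) r)
    (fun n m => (isOpen_kleeneGraph₂ n m).preimage
      ((Baire.continuous_left.comp continuous_fst).prodMk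
        ((Baire.continuous_right.comp continuous_fst).prodMk continuous_snd)))
    fun _ _ _ _ _ => KleeneGraph₂.unique
  obtain ⟨s, hs⟩ := exists_kleene_code_of_continuous₂ (G := fun p q => c (Baire.pair p q))
    (hc.comp Baire.continuous_pair)
  refine ⟨k, s, hk, fun (p q : Baire) => ?_, fun (p q r : Baire) => ?_⟩
  · change Part.Dom ((kleeneApp s p).bind fun f => kleeneApp f q)
    rw [hs]
    trivial
  · change ((kleeneApp s p).bind fun f => kleeneApp f q).bind (fun f => kleeneApp f r) =
      (kleeneApp p r).bind fun x => (kleeneApp q r).bind fun y => kleeneApp x y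
    rw [hs, Part.bind_some]
    refine Part.ext fun d => (hcs _ _ _).trans ?_
    rw [Baire.left_pair, Baire.right_pair]
    exact forall_kleeneGraph₂_iff

/-! ## Stable maps and their traces -/

namespace CohSpace

variable {X Y Z U : CohSpace.{v}}

theorem Clique.ext {a b : X.Clique} (h : ∀ x, x ∈ a.1 ↔ x ∈ b.1) : a = b :=
  Subtype.ext (Set.ext h)

theorem Clique.coherent_self (a : X.Clique) : a.Coherent a := a.2

theorem Clique.Coherent.symm {a b : X.Clique} (h : a.Coherent b) : b.Coherent a :=
  fun x hx y hy => X.symm _ _ (h y hy x hx)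

theorem Clique.coherent_of_le {a b : X.Clique} (h : a ≤ b) : a.Coherent b :=
  fun x hx y hy => b.2 x (h hx) y hy

theorem Clique.inter_le_left (a b : X.Clique) : a.inter b ≤ a := fun _ hx => And.left hx

theorem Clique.inter_le_right (a b : X.Clique) : a.inter b ≤ b := fun _ hx => And.right hx

/-- The clique of a token of `!X`. -/
def Clique.ofFinset (s : (bang X).Token) : X.Clique := ⟨(s.1 : Set X.Token), s.2⟩

theorem Clique.ofFinset_le {s : (bang X).Token} {a : X.Clique} (h : ∀ x ∈ s.1, x ∈ a.1) :
    Clique.ofFinset s ≤ a := h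

/-- A finite set of tokens of a clique, as a token of `!X`. -/
def Clique.finset (a : X.Clique) (s : Finset X.Token) (h : ∀ x ∈ s, x ∈ a.1) :
    (bang X).Token := ⟨s, fun x hx y hy => a.2 x (h x hx) y (h y hy)⟩

/-- The union of a directed family is itself a clique, hence an upper bound. -/
theorem Clique.isLUB_iUnion {d : Set X.Clique} (hd : DirectedOn (· ≤ ·) d) {a : X.Clique}
    (ha : IsLUB d a) {x : X.Token} (hx : x ∈ a.1) : ∃ b ∈ d, x ∈ b.1 := by
  let c : X.Clique := ⟨{x | ∃ b ∈ d, x ∈ b.1}, by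
    rintro x ⟨b, hb, hxb⟩ y ⟨b', hb', hyb⟩
    obtain ⟨b'', -, h, h'⟩ := hd b hb b' hb'
    exact b''.2 x (h hxb) y (h' hyb)⟩
  exact ha.2 (show c ∈ upperBounds d from fun b hb y hy => ⟨b, hb, hy⟩) hx

theorem Clique.exists_mem_of_subset_isLUB {d : Set X.Clique} (hne : d.Nonempty)
    (hd : DirectedOn (· ≤ ·) d) {a : X.Clique} (ha : IsLUB d a) (s : Finset X.Token)
    (hs : ∀ x ∈ s, x ∈ a.1) : ∃ b ∈ d, ∀ x ∈ s, x ∈ b.1 := by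
  classical
  induction s using Finset.induction_on with
  | empty => exact ⟨_, hne.some_mem, by simp⟩
  | insert x s _ ih =>
    obtain ⟨b, hb, hsb⟩ := ih fun y hy => hs y (Finset.mem_insert_of_mem hy)
    obtain ⟨b', hb', hx⟩ := Clique.isLUB_iUnion hd ha (hs x (Finset.mem_insert_self _ _))
    obtain ⟨c, hc, h, h'⟩ := hd b hb b' hb'
    refine ⟨c, hc, fun y hy => ?_⟩
    rcases Finset.mem_insert.1 hy with rfl | hy
    · exact h' hx
    · exact h (hsb y hy)

/-- A map is stable if every token of a value has a finite support that decides whether the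
token belongs to the values at coherent cliques. -/
theorem isStable_of_support {F : X.Clique → Y.Clique}
    (h : ∀ a, ∀ y ∈ (F a).1, ∃ s : Finset X.Token,
      ∀ b, a.Coherent b → (y ∈ (F b).1 ↔ ∀ x ∈ s, x ∈ b.1)) : IsStable F := by
  have hm : Monotone F := fun a b hab y hy => by
    obtain ⟨s, hs⟩ := h a y hy
    exact (hs b (Clique.coherent_of_le hab)).2 fun x hx =>
      hab ((hs a a.coherent_self).1 hy x hx)
  refine ⟨fun d hne hd a ha => ⟨?_, fun c hc y hy => ?_⟩, fun a b hab => Clique.ext fun y => ?_⟩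
  · rintro _ ⟨b, hb, rfl⟩
    exact hm (ha.1 hb)
  · obtain ⟨s, hs⟩ := h a y hy
    obtain ⟨b, hb, hsb⟩ := Clique.exists_mem_of_subset_isLUB hne hd ha s
      ((hs a a.coherent_self).1 hy)
    exact hc ⟨b, hb, rfl⟩ ((hs b (Clique.coherent_of_le (ha.1 hb)).symm).2 hsb)
  · refine ⟨fun hy => ⟨hm (a.inter_le_left b) hy, hm (a.inter_le_right b) hy⟩, fun hy => ?_⟩
    obtain ⟨s, hs⟩ := h a y hy.1
    exact (hs _ (Clique.coherent_of_le (a.inter_le_left b)).symm).2 fun x hx =>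
      ⟨(hs a a.coherent_self).1 hy.1 x hx, (hs b hab).1 hy.2 x hx⟩

theorem isStable_of_singleton_support {F : X.Clique → Y.Clique}
    (h : ∀ a, ∀ y ∈ (F a).1, ∃ x, ∀ b : X.Clique, y ∈ (F b).1 ↔ x ∈ b.1) : IsStable F :=
  isStable_of_support fun a y hy => by
    obtain ⟨x, hx⟩ := h a y hy
    exact ⟨{x}, fun b _ => (hx b).trans
      ⟨fun hb z hz => Finset.mem_singleton.1 hz ▸ hb, fun hb => hb x (Finset.mem_singleton_self x)⟩⟩

/-- Every clique is the directed supremum of its finite subcliques. -/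
theorem exists_finite_of_scottContinuous {F : X.Clique → Y.Clique} (hF : ScottContinuous F)
    {a : X.Clique} {y : Y.Token} (hy : y ∈ (F a).1) :
    ∃ s : (bang X).Token, (∀ x ∈ s.1, x ∈ a.1) ∧ y ∈ (F (Clique.ofFinset s)).1 := by
  classical
  let d : Set X.Clique := {b | ∃ s : (bang X).Token, (∀ x ∈ s.1, x ∈ a.1) ∧
    b = Clique.ofFinset s}
  have hne : d.Nonempty := ⟨_, a.finset ∅ (by simp), by simp [Clique.finset], rfl⟩
  have hd : DirectedOn (· ≤ ·) d := by
    rintro _ ⟨s, hs, rfl⟩ _ ⟨t, ht, rfl⟩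
    have hst : ∀ x ∈ s.1 ∪ t.1, x ∈ a.1 := fun x hx =>
      (Finset.mem_union.1 hx).elim (hs x) (ht x)
    exact ⟨_, ⟨a.finset _ hst, hst, rfl⟩, fun x hx => Finset.mem_union_left _ hx,
      fun x hx => Finset.mem_union_right _ hx⟩
  have ha : IsLUB d a := by
    refine ⟨?_, fun c hc x hx => ?_⟩
    · rintro _ ⟨s, hs, rfl⟩
      exact hs
    · have hxa : ∀ z ∈ ({x} : Finset X.Token), z ∈ a.1 := fun z hz => by
        rwa [Finset.mem_singleton.1 hz]
      exact hc ⟨a.finset {x} hxa, hxa, rfl⟩ (Finset.mem_singleton_self x)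
  obtain ⟨_, ⟨_, ⟨s, hs, rfl⟩, rfl⟩, hy⟩ := Clique.isLUB_iUnion
    (hd.mono_comp (fun _ _ h => hF.monotone h)) (hF hne hd ha) hy
  exact ⟨s, hs, hy⟩

/-- Take a finite subclique of least cardinality that yields the token. Intersecting it with a
coherent clique that also yields the token keeps the token, by stability, so minimality leaves
nothing to remove. -/
theorem IsStable.exists_support {F : X.Clique → Y.Clique} (hF : IsStable F) {a : X.Clique}
    {y : Y.Token} (hy : y ∈ (F a).1) : ∃ s : (bang X).Token, (∀ x ∈ s.1, x ∈ a.1) ∧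
      ∀ b, a.Coherent b → (y ∈ (F b).1 ↔ ∀ x ∈ s.1, x ∈ b.1) := by
  classical
  have hex : ∃ n, ∃ s : (bang X).Token, s.1.card = n ∧ (∀ x ∈ s.1, x ∈ a.1) ∧
      y ∈ (F (Clique.ofFinset s)).1 := by
    obtain ⟨s, hs⟩ := exists_finite_of_scottContinuous hF.1 hy
    exact ⟨_, s, rfl, hs⟩
  obtain ⟨s, hcard, hsa, hsy⟩ := Nat.find_spec hex
  refine ⟨s, hsa, fun b hab => ⟨fun hyb x hx => ?_, fun h =>
    hF.1.monotone (Clique.ofFinset_le h) hsy⟩⟩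
  have hcoh : (Clique.ofFinset s).Coherent b := fun x hx z hz => hab x (hsa x hx) z hz
  have hyi : y ∈ (F ((Clique.ofFinset s).inter b)).1 := by
    rw [hF.2 _ _ hcoh]
    exact ⟨hsy, hyb⟩
  have hta : ∀ x ∈ s.1.filter (· ∈ b.1), x ∈ a.1 := fun x hx =>
    hsa x (Finset.mem_filter.1 hx).1
  have hle := Nat.find_min' hex ⟨a.finset _ hta, rfl, hta, hF.1.monotone
    (show (Clique.ofFinset s).inter b ≤ Clique.ofFinset (a.finset _ hta) from
      fun z hz => Finset.mem_filter.2 hz) hyi⟩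
  rw [← hcard] at hle
  have heq := Finset.eq_of_subset_of_card_le (Finset.filter_subset (· ∈ b.1) s.1) hle
  rw [← heq] at hx
  exact (Finset.mem_filter.1 hx).2

/-- The trace of a map: the pairs of a finite clique and a token that it supports. -/
def traceSet (F : X.Clique → Y.Clique) : Set (stableHom X Y).Token :=
  {p | ∀ b, (Clique.ofFinset p.1).Coherent b →
    (p.2 ∈ (F b).1 ↔ ∀ x ∈ (p.1 : (bang X).Token).1, x ∈ b.1)}

theorem mem_of_mem_traceSet {F : X.Clique → Y.Clique} {p : (stableHom X Y).Token}
    (h : p ∈ traceSet F) : p.2 ∈ (F (Clique.ofFinset p.1)).1 :=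
  (h _ (Clique.coherent_self _)).2 fun _ hx => hx

/-- The trace of a stable map, as a clique. -/
def trace (F : X.Clique → Y.Clique) (hF : IsStable F) : (stableHom X Y).Clique :=
  ⟨traceSet F, by
    intro p hp q hq
    by_cases hpq : p = q
    · exact Or.inl hpq
    -- Two coherent supports of the same token contain each other, so distinct tokens of the trace
    -- over coherent arguments have distinct outputs.
    refine Or.inr fun hc => ⟨fun h => hpq (Prod.ext (Subtype.ext (Finset.Subset.antisymm ?_ ?_)) h),
      hF.coherent (a := Clique.ofFinset p.1) (b := Clique.ofFinset q.1) hc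
        _ (mem_of_mem_traceSet hp) _ (mem_of_mem_traceSet hq)⟩
    · exact (hp (Clique.ofFinset q.1) hc).1 (h ▸ mem_of_mem_traceSet hq)
    · exact (hq (Clique.ofFinset p.1) (Clique.Coherent.symm hc)).1
        (h ▸ mem_of_mem_traceSet hp)⟩

theorem evalTrace_trace {F : X.Clique → Y.Clique} (hF : IsStable F) (a : X.Clique) :
    evalTrace (trace F hF) a = F a := by
  refine Clique.ext fun y => ⟨?_, fun hy => ?_⟩
  · rintro ⟨s, hs, hp⟩
    exact hF.1.monotone (Clique.ofFinset_le hs) (mem_of_mem_traceSet hp)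
  · obtain ⟨s, hsa, hs⟩ := hF.exists_support hy
    have hsy : y ∈ (F (Clique.ofFinset s)).1 :=
      (hs _ (Clique.coherent_of_le (Clique.ofFinset_le hsa)).symm).2 fun _ hx => hx
    -- The support `s` is known to decide only for cliques coherent with `a`, whereas the trace asks
    -- about those coherent with `s`. A support `t` taken at `s` decides for these, and `s` and `t`
    -- contain each other.
    obtain ⟨t, hts, ht⟩ := hF.exists_support hsy
    have hta : Clique.ofFinset t ≤ a := fun x hx => hsa x (hts x hx)
    have hst := (hs _ (Clique.coherent_of_le hta).symm).1
      ((ht _ (Clique.coherent_of_le (Clique.ofFinset_le hts)).symm).2 fun _ hx => hx)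
    refine ⟨s, hsa, fun b hb => (ht b hb).trans ⟨fun h x hx => h x (hst x hx),
      fun h x hx => h x (hts x hx)⟩⟩

/-! ## Products -/

/-- The product of two coherence spaces. -/
def prod (X Y : CohSpace.{v}) : CohSpace.{v} where
  Token := X.Token ⊕ Y.Token
  coh
    | .inl x, .inl x' => X.coh x x'
    | .inr y, .inr y' => Y.coh y y'
    | _, _ => True
  countable_token := by
    have := X.countable_token
    have := Y.countable_token
    infer_instance
  refl
    | .inl x => X.refl x
    | .inr y => Y.refl y
  symm
    | .inl x, .inl x' => X.symm x x'
    | .inr y, .inr y' => Y.symm y y'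
    | .inl _, .inr _ => fun _ => trivial
    | .inr _, .inl _ => fun _ => trivial

/-- The clique of a product with given components. -/
def Clique.pair (a : X.Clique) (b : Y.Clique) : (prod X Y).Clique :=
  ⟨{z | Sum.elim (· ∈ a.1) (· ∈ b.1) z}, by
    rintro (x | x) hx (y | y) hy
    · exact a.2 x hx y hy
    · trivial
    · trivial
    · exact b.2 x hx y hy⟩

/-- The first component of a clique of a product. -/
def Clique.fst (c : (prod X Y).Clique) : X.Clique :=
  ⟨{x | Sum.inl x ∈ c.1}, fun _ hx _ hy => c.2 _ hx _ hy⟩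

/-- The second component of a clique of a product. -/
def Clique.snd (c : (prod X Y).Clique) : Y.Clique :=
  ⟨{y | Sum.inr y ∈ c.1}, fun _ hx _ hy => c.2 _ hx _ hy⟩

@[simp] theorem Clique.fst_pair (a : X.Clique) (b : Y.Clique) : (a.pair b).fst = a := rfl

@[simp] theorem Clique.snd_pair (a : X.Clique) (b : Y.Clique) : (a.pair b).snd = b := rfl

theorem Clique.coherent_pair {a a' : X.Clique} {b b' : Y.Clique} (ha : a.Coherent a')
    (hb : b.Coherent b') : (a.pair b).Coherent (a'.pair b') := by
  rintro (x | x) hx (y | y) hy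
  · exact ha x hx y hy
  · trivial
  · trivial
  · exact hb x hx y hy

theorem IsStable.fst : IsStable (fun c : (prod X Y).Clique => c.fst) :=
  isStable_of_singleton_support fun _ x _ => ⟨Sum.inl x, fun _ => Iff.rfl⟩

theorem IsStable.snd : IsStable (fun c : (prod X Y).Clique => c.snd) :=
  isStable_of_singleton_support fun _ x _ => ⟨Sum.inr x, fun _ => Iff.rfl⟩

theorem IsStable.pair {F : Z.Clique → X.Clique} {G : Z.Clique → Y.Clique} (hF : IsStable F)
    (hG : IsStable G) : IsStable (fun a => (F a).pair (G a)) := by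
  refine isStable_of_support ?_
  rintro a (x | y) h
  · obtain ⟨s, -, hs⟩ := hF.exists_support h
    exact ⟨s.1, hs⟩
  · obtain ⟨s, -, hs⟩ := hG.exists_support h
    exact ⟨s.1, hs⟩

theorem IsStable.const (c : Y.Clique) : IsStable (fun _ : X.Clique => c) :=
  isStable_of_support fun _ _ hy => ⟨∅, fun _ _ => ⟨by simp, fun _ => hy⟩⟩

/-! ## Currying and evaluation -/

/-- A token of the value is supported by one token of the trace together with the finite argument it
requires. Another trace token with the same output, over a coherent argument, must coincide with it.
-/
theorem IsStable.eval : IsStable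
    (fun c : (prod (stableHom X Y) X).Clique => evalTrace c.fst c.snd) := by
  classical
  refine isStable_of_support ?_
  rintro c y ⟨s, hs, hp⟩
  refine ⟨insert (Sum.inl (s, y)) (s.1.image Sum.inr), fun c' hc => ⟨?_, fun h => ?_⟩⟩
  · rintro ⟨t, ht, hq⟩
    have hst : ((s, y) : (stableHom X Y).Token) = (t, y) := by
      rcases hc _ hp _ hq with h | h
      · exact h
      · exact absurd rfl (h fun x hx z hz => hc _ (hs x hx) _ (ht z hz)).1
    obtain rfl : s = t := congrArg Prod.fst hst
    intro z hz
    rcases Finset.mem_insert.1 hz with rfl | hz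
    · exact hq
    · obtain ⟨x, hx, rfl⟩ := Finset.mem_image.1 hz
      exact ht x hx
  · exact ⟨s, fun x hx => h _ (Finset.mem_insert_of_mem (Finset.mem_image_of_mem _ hx)),
      h _ (Finset.mem_insert_self _ _)⟩

theorem IsStable.section {F : (prod X Y).Clique → Z.Clique} (hF : IsStable F) (a : X.Clique) :
    IsStable (fun b => F (a.pair b)) :=
  hF.comp ((IsStable.const a).pair (IsStable.id _))

theorem IsStable.curry {F : (prod X Y).Clique → Z.Clique} (hF : IsStable F) :
    IsStable (fun a => trace (fun b => F (a.pair b)) (hF.section a)) := by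
  classical
  refine isStable_of_support ?_
  rintro a ⟨t, z⟩ hp
  have hp' : ∀ b, (Clique.ofFinset t).Coherent b →
    (z ∈ (F (a.pair b)).1 ↔ ∀ x ∈ t.1, x ∈ b.1) := hp
  have hz : z ∈ (F (a.pair (Clique.ofFinset t))).1 :=
    mem_of_mem_traceSet (F := fun b => F (a.pair b)) hp
  obtain ⟨s, -, hs⟩ := hF.exists_support hz
  have hs' : ∀ a' b, a.Coherent a' → (Clique.ofFinset t).Coherent b →
      (z ∈ (F (a'.pair b)).1 ↔ (∀ x ∈ s.1.toLeft, x ∈ a'.1) ∧ ∀ x ∈ s.1.toRight, x ∈ b.1) := by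
    intro a' b ha hb
    refine (hs _ (Clique.coherent_pair ha hb)).trans ⟨fun h => ⟨fun x hx => ?_, fun x hx => ?_⟩,
      fun h => ?_⟩
    · exact h _ (Finset.mem_toLeft.1 hx)
    · exact h _ (Finset.mem_toRight.1 hx)
    · rintro (x | x) hx
      · exact h.1 x (Finset.mem_toLeft.2 hx)
      · exact h.2 x (Finset.mem_toRight.2 hx)
  have ht := Clique.coherent_self (Clique.ofFinset t)
  -- The left part of the support is the demand on the parameter. Once it is met, only the right
  -- part matters, and comparison with `a` shows that this condition is equivalent to containing
  -- `t`.
  refine ⟨s.1.toLeft, fun a' ha => ⟨fun h => ((hs' a' _ ha ht).1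
    (mem_of_mem_traceSet (F := fun b => F (a'.pair b)) h)).1,
    fun h b hb => ?_⟩⟩
  have h1 := hs' a' b ha hb
  have h2 := hs' a b a.coherent_self hb
  have h3 := ((hs' a _ a.coherent_self ht).1 hz).1
  have h4 := hp' b hb
  exact h1.trans (by rw [← h4, h2]; exact and_congr_left' (iff_of_true h h3))

/-! ## Embeddings -/

/-- The image of a clique under an embedding of coherence spaces. -/
def Clique.map (e : X.coh ↪r Y.coh) (a : X.Clique) : Y.Clique :=
  ⟨e '' a.1, by
    rintro _ ⟨x, hx, rfl⟩ _ ⟨y, hy, rfl⟩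
    exact e.map_rel_iff.2 (a.2 x hx y hy)⟩

@[simp] theorem Clique.pullback_map (e : X.coh ↪r Y.coh) (a : X.Clique) :
    (a.map e).pullback e = a :=
  Clique.ext fun _ => e.injective.mem_set_image

theorem IsStable.pullback (e : X.coh ↪r Y.coh) : IsStable (Clique.pullback e) :=
  isStable_of_singleton_support fun _ x _ => ⟨e x, fun _ => Iff.rfl⟩

theorem IsStable.map (e : X.coh ↪r Y.coh) : IsStable (Clique.map e) := by
  refine isStable_of_singleton_support ?_
  rintro a _ ⟨x, hx, rfl⟩
  exact ⟨x, fun b => e.injective.mem_set_image⟩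

/-! ## The combinatory algebra of a reflexive coherence space -/

/-- The application of the cliques of `U` as an operation. -/
def cohApp (e : (U.stableHom U).coh ↪r U.coh) (a b : U.Clique) : U.Clique :=
  evalTrace (a.pullback e) b

/-- The code of a stable map. -/
def code (e : (U.stableHom U).coh ↪r U.coh) (F : U.Clique → U.Clique) (hF : IsStable F) :
    U.Clique :=
  (trace F hF).map e

variable (e : (U.stableHom U).coh ↪r U.coh)

@[simp] theorem cohApp_code {F : U.Clique → U.Clique} (hF : IsStable F) (a : U.Clique) :
    cohApp e (code e F hF) a = F a := by
  rw [cohApp, code, Clique.pullback_map, evalTrace_trace]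

theorem IsStable.cohApp {F G : X.Clique → U.Clique} (hF : IsStable F) (hG : IsStable G) :
    IsStable (fun a => cohApp e (F a) (G a)) :=
  IsStable.eval.comp (((IsStable.pullback e).comp hF).pair hG)

theorem IsStable.curry_code {F : (prod X U).Clique → U.Clique} (hF : IsStable F) :
    IsStable (fun a => code e (fun b => F (a.pair b)) (hF.section a)) :=
  (IsStable.map e).comp hF.curry

theorem exists_code₂ {F : (prod U U).Clique → U.Clique} (hF : IsStable F) :
    ∃ r, ∀ a b, cohApp e (CohSpace.cohApp e r a) b = F (a.pair b) :=
  ⟨code e _ (hF.curry_code e), fun a b => by rw [cohApp_code, cohApp_code]⟩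

theorem exists_code₃ {F : (prod (prod U U) U).Clique → U.Clique} (hF : IsStable F) :
    ∃ r, ∀ a b c, cohApp e (CohSpace.cohApp e (CohSpace.cohApp e r a) b) c =
      F ((a.pair b).pair c) := by
  obtain ⟨r, hr⟩ := exists_code₂ e (hF.curry_code e)
  exact ⟨r, fun a b c => by rw [hr, cohApp_code]⟩

theorem cohAlgebra_app₂ (a b c : U.Clique) :
    (cohAlgebra U e).app₂ a b c = Part.some (cohApp e (cohApp e a b) c) :=
  Part.bind_some _ _

theorem cohAlgebra_isPCA : (cohAlgebra U e).IsPCA := by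
  obtain ⟨k, hk⟩ := exists_code₂ e (IsStable.fst (X := U) (Y := U))
  have h1 : IsStable fun c : (prod (prod U U) U).Clique => c.fst.fst :=
    IsStable.fst.comp IsStable.fst
  have h2 : IsStable fun c : (prod (prod U U) U).Clique => c.fst.snd :=
    IsStable.snd.comp IsStable.fst
  obtain ⟨s, hs⟩ := exists_code₃ e
    ((h1.cohApp e IsStable.snd).cohApp e (h2.cohApp e IsStable.snd))
  refine ⟨k, s, fun (a b : U.Clique) => ?_, fun (a b : U.Clique) => ?_,
    fun (a b c : U.Clique) => ?_⟩
  · exact (cohAlgebra_app₂ e k a b).trans (congrArg Part.some (hk a b))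
  · rw [cohAlgebra_app₂ e s a b]
    trivial
  · have h : (cohAlgebra U e).app₃ s a b c =
        (cohAlgebra U e).app (cohApp e (cohApp e s a) b) c :=
      (congrArg (fun x => Part.bind x fun g => (cohAlgebra U e).app g c)
        (cohAlgebra_app₂ e s a b)).trans (Part.bind_some _ _)
    refine h.trans ?_
    change Part.some (cohApp e (cohApp e (cohApp e s a) b) c) =
      (Part.some (cohApp e a c)).bind fun x => (Part.some (cohApp e b c)).bind fun y =>
        Part.some (cohApp e x y)
    rw [Part.bind_some, Part.bind_some, hs]
    rfl

/-! ## A universal coherence space -/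

/-- The coherence space of finite binary sequences, where a sequence of length `n` lists its
coherence with the sequences in a countable universal graph that come before it. -/
def universalSpace : CohSpace.{v} where
  Token := ULift (List Bool)
  coh l m := l = m ∨ l.down[m.down.length]? = some true ∨ m.down[l.down.length]? = some true
  countable_token := inferInstance
  refl _ := Or.inl rfl
  symm _ _ h := by
    rcases h with h | h | h
    exacts [Or.inl h.symm, Or.inr (Or.inr h), Or.inr (Or.inl h)]

/-- The token numbered `c x` goes to a sequence of that length whose bit `i` records coherence with
the token numbered `i`. The length recovers the number, and the longer of two sequences decides
their coherence. -/
theorem universalSpace_isUniversal : universalSpace.{v}.IsUniversal := by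
  classical
  intro X
  have := X.countable_token
  obtain ⟨c, hc⟩ := exists_injective_nat X.Token
  let f : X.Token → List Bool := fun x =>
    (List.range (c x)).map fun i => decide (∃ y, c y = i ∧ X.coh x y)
  have hlen : ∀ x, (f x).length = c x := fun x => by simp [f]
  have hinj : Function.Injective f := fun x y h => hc (by rw [← hlen, ← hlen, h])
  have hget : ∀ x y, (f x)[c y]? = some true ↔ c y < c x ∧ X.coh x y := by
    intro x y
    simp only [f, List.getElem?_map, Option.map_eq_some_iff, List.getElem?_eq_some_iff,
      List.length_range, List.getElem_range, decide_eq_true_eq]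
    constructor
    · rintro ⟨i, ⟨hi, rfl⟩, y', hy, hxy⟩
      obtain rfl := hc hy
      exact ⟨hi, hxy⟩
    · rintro ⟨hi, hxy⟩
      exact ⟨_, ⟨hi, rfl⟩, y, rfl, hxy⟩
  refine ⟨⟨⟨fun x => ⟨f x⟩, fun x y h => hinj (congrArg ULift.down h)⟩, fun {x y} => ?_⟩⟩
  change (ULift.up (f x) = ULift.up (f y) ∨ (f x)[(f y).length]? = some true ∨
    (f y)[(f x).length]? = some true) ↔ X.coh x y
  rw [hlen, hlen, hget, hget]
  constructor
  · rintro (h | h | h)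
    · obtain rfl := hinj (congrArg ULift.down h)
      exact X.refl _
    · exact h.2
    · exact X.symm _ _ h.2
  · intro h
    rcases lt_trichotomy (c x) (c y) with hxy | hxy | hxy
    · exact Or.inr (Or.inr ⟨hxy, X.symm _ _ h⟩)
    · exact Or.inl (by rw [hc hxy])
    · exact Or.inr (Or.inl ⟨hxy, h⟩)

end CohSpace

namespace CohSpace

variable {X Y U : CohSpace.{v}}

/-! ## Sequences as cliques -/

/-- The coherence space of partial functions on the natural numbers. -/
def baireSpace : CohSpace.{v} where
  Token := ULift (ℕ × ℕ)
  coh x y := x.down.1 = y.down.1 → x.down.2 = y.down.2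
  countable_token := inferInstance
  refl _ _ := rfl
  symm _ _ h h' := (h h'.symm).symm

/-- The token of `baireSpace` for the value `m` at `n`. -/
def entry (n m : ℕ) : baireSpace.{v}.Token := ⟨(n, m)⟩

/-- The graph of a sequence. -/
def graph (p : Baire) : baireSpace.{v}.Clique :=
  ⟨{x | p x.down.1 = x.down.2}, fun x hx y hy h => by
    rw [← show p x.down.1 = x.down.2 from hx, ← show p y.down.1 = y.down.2 from hy, h]⟩

theorem entry_mem_graph {p : Baire} {n m : ℕ} :
    entry n m ∈ (graph.{v} p).1 ↔ p n = m := Iff.rfl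

theorem Clique.Coherent.entry {a b : baireSpace.{v}.Clique} (h : a.Coherent b) {n m m' : ℕ}
    (ha : entry n m ∈ a.1) (hb : CohSpace.entry n m' ∈ b.1) : m = m' :=
  h _ ha _ hb rfl

theorem graph_injective : Function.Injective graph.{v} := fun p q h => funext fun n => by
  have : entry n (p n) ∈ (graph.{v} q).1 := h ▸ entry_mem_graph.2 rfl
  exact (entry_mem_graph.1 this).symm

/-- `d` has value `m` at `n` if it is the result of the application of Kleene's second algebra
to the partial functions `a` and `b`, with `w` the part of `b` of length `k` that is used. -/
def KleeneWitness (a b : baireSpace.{v}.Clique) (n m k : ℕ) (w : Baire) : Prop :=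
  (∀ j < k, entry j (w j) ∈ b.1) ∧ entry (kleeneCode w n k) (m + 1) ∈ a.1 ∧
    ∀ j < k, entry (kleeneCode w n j) 0 ∈ a.1

/-- Searches on coherent inputs read the same entries and stop at the same place. This determinism
is what makes the application stable. -/
theorem KleeneWitness.unique {a a' b b' : baireSpace.{v}.Clique} (ha : a.Coherent a')
    (hb : b.Coherent b') {n m m' k k' : ℕ} {w w' : Baire} (h : KleeneWitness a b n m k w)
    (h' : KleeneWitness a' b' n m' k' w') : m = m' ∧ k = k' ∧ ∀ j < k, w j = w' j := by
  obtain ⟨hw, hk, hj⟩ := h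
  obtain ⟨hw', hk', hj'⟩ := h'
  rcases lt_trichotomy k k' with h | rfl | h
  · have := hj' k h
    rw [← kleeneCode_congr n fun j hj => hb.entry (hw j hj) (hw' j (hj.trans h))] at this
    exact absurd (ha.entry hk this) (by omega)
  · have hww := fun j hj => hb.entry (hw j hj) (hw' j hj)
    rw [← kleeneCode_congr n hww] at hk'
    exact ⟨Nat.succ_injective (ha.entry hk hk'), rfl, hww⟩
  · have := hj k' h
    rw [kleeneCode_congr n fun j hj => hb.entry (hw j (hj.trans h)) (hw' j hj)] at this
    exact absurd (ha.entry this hk') (by omega)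

/-- The application of Kleene's second algebra, extended to partial functions. -/
def kleeneClique (a b : baireSpace.{v}.Clique) : baireSpace.{v}.Clique :=
  ⟨{x | ∃ k w, KleeneWitness a b x.down.1 x.down.2 k w}, by
    rintro ⟨n, m⟩ ⟨k, w, h⟩ ⟨n', m'⟩ ⟨k', w', h'⟩ (rfl : n = n')
    exact (h.unique a.coherent_self b.coherent_self h').1⟩

theorem IsStable.kleeneClique : IsStable
    (fun c : (prod baireSpace.{v} baireSpace.{v}).Clique => kleeneClique c.fst c.snd) := by
  classical
  refine isStable_of_support ?_
  rintro c ⟨n, m⟩ ⟨k, w, h⟩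
  -- The support is everything the search reads, including the zeros that rule out shorter prefixes.
  refine ⟨insert (Sum.inl (entry (kleeneCode w n k) (m + 1)))
    ((Finset.range k).image (fun j => Sum.inr (entry j (w j))) ∪
      (Finset.range k).image fun j => Sum.inl (entry (kleeneCode w n j) 0)), fun c' hc =>
    ⟨?_, fun h' => ⟨k, w, fun j hj => ?_, ?_, fun j hj => ?_⟩⟩⟩
  · rintro ⟨k', w', h'⟩
    obtain ⟨-, rfl, hw⟩ := h.unique (IsStable.fst.coherent hc) (IsStable.snd.coherent hc) h'
    obtain ⟨h1, h2, h3⟩ := h'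
    intro z hz
    rcases Finset.mem_insert.1 hz with rfl | hz
    · rw [kleeneCode_congr n hw]
      exact h2
    rcases Finset.mem_union.1 hz with hz | hz
    · obtain ⟨j, hj, rfl⟩ := Finset.mem_image.1 hz
      rw [hw j (Finset.mem_range.1 hj)]
      exact h1 j (Finset.mem_range.1 hj)
    · obtain ⟨j, hj, rfl⟩ := Finset.mem_image.1 hz
      have hj := Finset.mem_range.1 hj
      rw [kleeneCode_congr n fun i hi => hw i (hi.trans hj)]
      exact h3 j hj
  · exact h' _ (Finset.mem_insert_of_mem (Finset.mem_union_left _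
      (Finset.mem_image_of_mem _ (Finset.mem_range.2 hj))))
  · exact h' _ (Finset.mem_insert_self _ _)
  · exact h' _ (Finset.mem_insert_of_mem (Finset.mem_union_right _
      (Finset.mem_image_of_mem _ (Finset.mem_range.2 hj))))

theorem kleeneClique_graph {α β d : Baire} (h : d ∈ kleeneApp α β) :
    kleeneClique (graph.{v} α) (graph β) = graph d := by
  rw [mem_kleeneApp] at h
  have hw : ∀ n, ∃ k, KleeneWitness (graph.{v} α) (graph β) n (d n) k β := fun n => by
    obtain ⟨k, hk, hj⟩ := h n
    exact ⟨k, fun j _ => rfl, hk, hj⟩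
  refine Clique.ext ?_
  rintro ⟨n, m⟩
  obtain ⟨k, hk⟩ := hw n
  constructor
  · rintro ⟨k', w', h'⟩
    exact (hk.unique (Clique.coherent_self _) (Clique.coherent_self _) h').1
  · rintro (rfl : d n = m)
    exact ⟨k, β, hk⟩

/-! ## Enumerations of cliques -/

/-- A numbering of the tokens. -/
noncomputable def tokenCode (X : CohSpace.{v}) : X.Token → ℕ :=
  have := X.countable_token
  (exists_injective_nat X.Token).choose

theorem tokenCode_injective (X : CohSpace.{v}) : Function.Injective X.tokenCode :=
  have := X.countable_token
  (exists_injective_nat X.Token).choose_spec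

/-- The sequence `p` enumerates the tokens of the clique `a`. -/
def Enumerates (p : Baire) (a : X.Clique) : Prop :=
  ∀ x, x ∈ a.1 ↔ ∃ n, p n = X.tokenCode x + 1

theorem Enumerates.unique {p : Baire} {a b : X.Clique} (ha : Enumerates p a)
    (hb : Enumerates p b) : a = b :=
  Clique.ext fun x => (ha x).trans (hb x).symm

theorem exists_enumerates (a : X.Clique) : ∃ p, Enumerates p a := by
  classical
  refine ⟨fun n => if ∃ x ∈ a.1, X.tokenCode x = n then n + 1 else 0, fun x => ⟨fun hx =>
    ⟨X.tokenCode x, if_pos ⟨x, hx, rfl⟩⟩, ?_⟩⟩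
  rintro ⟨n, hn⟩
  dsimp only at hn
  split_ifs at hn with h
  obtain ⟨y, hy, rfl⟩ := h
  rwa [← X.tokenCode_injective (Nat.succ_injective hn)]

/-- The values of a family of cliques that depends on a sequence in an open way can be
enumerated continuously. -/
theorem exists_continuous_enumerates (F : Baire → X.Clique)
    (hF : ∀ x, IsOpen {p | x ∈ (F p).1}) :
    ∃ G : Baire → Baire, Continuous G ∧ ∀ p, Enumerates (G p) (F p) := by
  obtain ⟨G, hG, h⟩ := Baire.exists_continuous_enumeration
    (fun p y => ∃ x, X.tokenCode x = y ∧ x ∈ (F p).1) fun y => by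
      simp only [Set.ofPred_exists]
      exact isOpen_iUnion fun x => isOpen_const.and (hF x)
  refine ⟨G, hG, fun p x => Iff.trans ⟨fun hx => ⟨x, rfl, hx⟩, ?_⟩ (h p _)⟩
  rintro ⟨y, hy, hp⟩
  rwa [← X.tokenCode_injective hy]

/-- A token of the value is produced by a finite part of the graph, and containing that part is an
open condition on the sequence. -/
theorem IsStable.exists_continuous_enumerates {F : baireSpace.{v}.Clique → X.Clique}
    (hF : IsStable F) : ∃ G : Baire → Baire, Continuous G ∧
      ∀ p, Enumerates (G p) (F (graph p)) := by
  refine CohSpace.exists_continuous_enumerates _ fun x => ?_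
  rw [isOpen_iff_mem_nhds]
  intro p hp
  obtain ⟨s, hsp, hs⟩ := exists_finite_of_scottContinuous hF.1 hp
  have h : ∀ᶠ q : Baire in nhds p, ∀ z ∈ s.1, q z.down.1 = z.down.2 :=
    (Finset.eventually_all s.1).2 fun z hz =>
      (Baire.isOpen_apply_eq continuous_id _ _).mem_nhds (hsp z hz)
  filter_upwards [h] with q hq
  exact hF.1.monotone (Clique.ofFinset_le hq) hs

/-- The token `x` is listed for the first time at position `k` of the sequence `w`, whose
initial part of length `k + 1` belongs to `b` and lists pairwise coherent tokens. -/
def FirstListing (b : baireSpace.{v}.Clique) (x : X.Token) (k : ℕ) (w : Baire) : Prop :=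
  (∀ j ≤ k, entry j (w j) ∈ b.1) ∧ w k = X.tokenCode x + 1 ∧
    (∀ j < k, w j ≠ X.tokenCode x + 1) ∧
    ∀ j ≤ k, ∀ j' ≤ k, ∀ y y', w j = X.tokenCode y + 1 → w j' = X.tokenCode y' + 1 → X.coh y y'

theorem FirstListing.unique {b b' : baireSpace.{v}.Clique} (hb : b.Coherent b') {x : X.Token}
    {k k' : ℕ} {w w' : Baire} (h : FirstListing b x k w) (h' : FirstListing b' x k' w') :
    k = k' ∧ ∀ j ≤ k, w j = w' j := by
  obtain ⟨hw, hk, hj, -⟩ := h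
  obtain ⟨hw', hk', hj', -⟩ := h'
  rcases lt_trichotomy k k' with h | rfl | h
  · exact absurd ((hb.entry (hw k le_rfl) (hw' k h.le)).symm.trans hk) (hj' k h)
  · exact ⟨rfl, fun j hj => hb.entry (hw j hj) (hw' j hj)⟩
  · exact absurd ((hb.entry (hw k' h.le) (hw' k' le_rfl)).trans hk') (hj k' h)

/-- The clique listed by a partial function on the natural numbers. -/
def listedClique (X : CohSpace.{v}) (b : baireSpace.{v}.Clique) : X.Clique :=
  ⟨{x | ∃ k w, FirstListing b x k w}, by
    rintro x ⟨k, w, hw, hk, -, hcoh⟩ y ⟨k', w', hw', hk', -, hcoh'⟩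
    rcases le_total k k' with h | h
    · exact hcoh' k h k' le_rfl x y
        ((b.coherent_self.entry (hw k le_rfl) (hw' k h)).symm.trans hk) hk'
    · exact hcoh k le_rfl k' h x y hk
        ((b.coherent_self.entry (hw k' h) (hw' k' le_rfl)).trans hk')⟩

/-- If any occurrence counted, a token listed twice would have two different minimal supports. The
prefix up to the first occurrence is the only one. The coherence test on that prefix makes the
result a clique even for sequences that enumerate none. -/
theorem IsStable.listedClique : IsStable (listedClique X) := by
  classical
  refine isStable_of_support ?_
  rintro b x ⟨k, w, h⟩
  refine ⟨(Finset.range (k + 1)).image fun j => entry j (w j), fun b' hb => ⟨?_, fun h' =>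
    ⟨k, w, fun j hj => h' _ (Finset.mem_image_of_mem _ (Finset.mem_range_succ_iff.2 hj)), h.2⟩⟩⟩
  rintro ⟨k', w', h'⟩ z hz
  obtain ⟨rfl, hw⟩ := h.unique hb h'
  obtain ⟨j, hj, rfl⟩ := Finset.mem_image.1 hz
  have hj := Finset.mem_range_succ_iff.1 hj
  rw [hw j hj]
  exact h'.1 j hj

theorem Enumerates.listedClique_graph {p : Baire} {a : X.Clique} (h : Enumerates p a) :
    listedClique X (graph p) = a := by
  refine Clique.ext fun x => ⟨?_, fun hx => ?_⟩
  · rintro ⟨k, w, hw, hk, -⟩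
    exact (h x).2 ⟨k, (entry_mem_graph.1 (hw k le_rfl)).trans hk⟩
  · have hex := (h x).1 hx
    exact ⟨Nat.find hex, p, fun j _ => rfl, Nat.find_spec hex, fun j hj => Nat.find_min hex hj,
      fun j _ j' _ y y' hy hy' => a.2 y ((h y).2 ⟨j, hy⟩) y' ((h y').2 ⟨j', hy'⟩)⟩

/-! ## Names of sequences in a coherence space -/

variable (i : baireSpace.{v}.coh ↪r U.coh)

/-- The clique that names the sequence `p`. -/
def name (p : Baire) : U.Clique := (graph p).map i

theorem name_injective : Function.Injective (name i) := fun p q h =>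
  graph_injective (by rw [← Clique.pullback_map i (graph p), ← Clique.pullback_map i (graph q)]
                      exact congrArg _ h)

@[simp] theorem pullback_name (p : Baire) : (name i p).pullback i = graph p :=
  Clique.pullback_map i _

theorem exists_stable_listing (X : CohSpace.{v}) : ∃ F : U.Clique → X.Clique, IsStable F ∧
    ∀ p a, Enumerates p a → F (name i p) = a :=
  ⟨_, IsStable.listedClique.comp (IsStable.pullback i), fun p a h => by
    rw [pullback_name, h.listedClique_graph]⟩

theorem IsStable.exists_continuous_enumerates_name {F : U.Clique → X.Clique} (hF : IsStable F) :
    ∃ G : Baire → Baire, Continuous G ∧ ∀ p, Enumerates (G p) (F (name i p)) :=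
  (hF.comp (IsStable.map i)).exists_continuous_enumerates

theorem exists_continuousOn_decoding : ∃ (D : Set Baire) (G : Baire → Baire),
    ContinuousOn G D ∧ ∀ p q, Enumerates q (name i p) → q ∈ D ∧ G q = p := by
  classical
  let G : Baire → Baire := fun q =>
    if h : ∃ p, Enumerates q (name i p) then h.choose else q
  have hG : ∀ p q, Enumerates q (name i p) → G q = p := by
    intro p q h
    have hex : ∃ p, Enumerates q (name i p) := ⟨p, h⟩
    simp only [G, dif_pos hex]
    exact name_injective i (hex.choose_spec.unique h)
  refine ⟨{q | ∃ p, Enumerates q (name i p)}, G, ?_, fun p q h => ⟨⟨p, h⟩, hG p q h⟩⟩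
  rw [Baire.continuousOn_iff]
  rintro q ⟨p, hp⟩ n
  -- The value at `n` is known as soon as its token appears in the enumeration, here at position
  -- `l`; every enumeration of a name with the same first `l + 1` entries decodes to the same value
  -- at `n`.
  obtain ⟨l, hl⟩ := (hp (i (entry n (p n)))).1 ⟨_, rfl, rfl⟩
  refine ⟨l + 1, ?_⟩
  rintro q' ⟨p', hp'⟩ hq
  obtain ⟨x, hx, hxi⟩ := (hp' (i (entry n (p n)))).2 ⟨l, (hq l l.lt_succ_self).trans hl⟩
  obtain rfl := i.injective hxi
  rw [hG p q hp, hG p' q' hp']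
  exact hx

theorem exists_stable_kleeneApp : ∃ F : (prod U U).Clique → U.Clique, IsStable F ∧
    ∀ α β d, d ∈ kleeneApp α β → F ((name i α).pair (name i β)) = name i d := by
  have h1 := (IsStable.pullback i).comp (IsStable.fst (X := U) (Y := U))
  have h2 := (IsStable.pullback i).comp (IsStable.snd (X := U) (Y := U))
  refine ⟨_, (IsStable.map i).comp (IsStable.kleeneClique.comp (h1.pair h2)), fun α β d h => ?_⟩
  simp only [Clique.fst_pair, Clique.snd_pair, pullback_name, kleeneClique_graph h]
  rfl

theorem exists_stable_of_continuousOn {D : Set Baire} {G : Baire → Baire}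
    (hG : ContinuousOn G D) : ∃ F : U.Clique → U.Clique, IsStable F ∧
      ∀ p ∈ D, F (name i p) = name i (G p) := by
  obtain ⟨α, hα⟩ := exists_kleene_code_of_continuousOn hG
  obtain ⟨F, hF, h⟩ := exists_stable_kleeneApp i
  exact ⟨_, hF.section (name i α), fun p hp => h α p _ (hα p hp)⟩

/-! ## The applicative retraction -/

variable (e : (U.stableHom U).coh ↪r U.coh)

theorem exists_continuous_enumerates_cohApp : ∃ G : Baire → Baire → Baire,
    Continuous (fun x : Baire × Baire => G x.1 x.2) ∧
      ∀ (p q : Baire) (a b : U.Clique), Enumerates p a → Enumerates q b →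
        Enumerates (G p q) (cohApp e a b) := by
  obtain ⟨G, hG, h⟩ := Baire.exists_continuous_enumeration
    -- A token is output when some trace token producing it is listed on the left and its finite
    -- argument is listed on the right, which is an open condition.
    (fun x y => ∃ (z : U.Token) (s : (bang U).Token), U.tokenCode z = y ∧
      (∃ n, Baire.left x n = U.tokenCode (e (s, z)) + 1) ∧
        ∀ w ∈ s.1, ∃ n, Baire.right x n = U.tokenCode w + 1) fun y => by
      simp only [Set.ofPred_exists]
      refine isOpen_iUnion fun z => isOpen_iUnion fun s => isOpen_const.and (IsOpen.and ?_ ?_)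
      · simp only [Set.ofPred_exists]
        exact isOpen_iUnion fun n => Baire.isOpen_apply_eq Baire.continuous_left _ _
      · simp only [Set.ofPred_forall, Set.ofPred_exists]
        exact s.1.finite_toSet.isOpen_biInter fun w _ =>
          isOpen_iUnion fun n => Baire.isOpen_apply_eq Baire.continuous_right _ _
  refine ⟨fun p q => G (Baire.pair p q), hG.comp Baire.continuous_pair, fun p q a b ha hb z => ?_⟩
  rw [← h, Baire.left_pair, Baire.right_pair]
  constructor
  · rintro ⟨s, hs, hz⟩
    exact ⟨z, s, rfl, (ha _).1 hz, fun w hw => (hb w).1 (hs w hw)⟩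
  · rintro ⟨z', s, hz', hp, hq⟩
    obtain rfl := U.tokenCode_injective hz'
    exact ⟨s, fun w hw => (hb w).2 (hq w hw), (ha _).2 hp⟩

theorem isApplicativeMorphism_name :
    kleeneSecond.IsApplicativeMorphism (cohAlgebra U e) fun p a => a = name i p := by
  obtain ⟨F, hF, h⟩ := exists_stable_kleeneApp i
  obtain ⟨r, hr⟩ := exists_code₂ e hF
  refine ⟨fun p => ⟨_, rfl⟩, r, ?_⟩
  rintro p q d _ _ rfl rfl hd
  refine ⟨_, Part.eq_some_iff.1 (cohAlgebra_app₂ e r _ _), ?_⟩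
  exact (hr _ _).trans (h p q d hd)

theorem isApplicativeMorphism_enumerates :
    (cohAlgebra U e).IsApplicativeMorphism kleeneSecond fun a p => Enumerates p a := by
  obtain ⟨G, hG, h⟩ := exists_continuous_enumerates_cohApp e
  obtain ⟨r, hr⟩ := exists_kleene_code_of_continuous₂ hG
  refine ⟨exists_enumerates, r, fun a b c p q hp hq hc => ?_⟩
  obtain rfl := Part.mem_some_iff.1 hc
  exact ⟨G p q, Part.eq_some_iff.1 (hr p q), h p q a b hp hq⟩

/-- The three translations are decoding an enumerated name, enumerating a name, and listing the
clique that a named sequence enumerates. -/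
theorem isApplicativeRetraction_name_enumerates :
    kleeneSecond.IsApplicativeRetraction (cohAlgebra U e) (fun p a => a = name i p)
      fun a p => Enumerates p a := by
  refine ⟨isApplicativeMorphism_name i e, isApplicativeMorphism_enumerates e, ?_, ?_, ?_⟩
  · obtain ⟨D, G, hG, h⟩ := exists_continuousOn_decoding i
    obtain ⟨t, ht⟩ := exists_kleene_code_of_continuousOn hG
    refine ⟨t, ?_⟩
    rintro p q ⟨_, rfl, hq⟩
    obtain ⟨hD, hGq⟩ := h p q hq
    exact ⟨G q, ht q hD, hGq.symm⟩
  · obtain ⟨G, hG, h⟩ := (IsStable.id U).exists_continuous_enumerates_name i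
    obtain ⟨t, ht⟩ := exists_kleene_code_of_continuous hG
    refine ⟨t, ?_⟩
    rintro p _ rfl
    exact ⟨G p, Part.eq_some_iff.1 (ht p), _, rfl, h p⟩
  · obtain ⟨F, hF, h⟩ := exists_stable_listing i U
    refine ⟨code e F hF, ?_⟩
    rintro a _ ⟨p, hp, rfl⟩
    exact ⟨_, Part.mem_some _, (h p a hp).symm.trans (cohApp_code e hF _).symm⟩

end CohSpace

/-! ## The coreflection -/

open CohSpace

namespace StabRep

/-- The partial function that sends a sequence enumerating a name to the named element. -/
noncomputable def enumPFun (X : StabRep.{u, v}) : Baire →. X.carrier :=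
  fun p => ⟨∃ s a, Enumerates p a ∧ s ∈ X.rep a, fun h => h.choose⟩

theorem mem_enumPFun {X : StabRep.{u, v}} {p : Baire} {s : X.carrier} :
    s ∈ X.enumPFun p ↔ ∃ a, Enumerates p a ∧ s ∈ X.rep a := by
  constructor
  · rintro ⟨h, rfl⟩
    exact h.choose_spec
  · rintro ⟨a, ha, hs⟩
    have h : ∃ s a, Enumerates p a ∧ s ∈ X.rep a := ⟨s, a, ha, hs⟩
    refine ⟨h, ?_⟩
    obtain ⟨b, hb, hs'⟩ := h.choose_spec
    obtain rfl := hb.unique ha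
    exact Part.mem_unique hs' hs

/-- The Baire-space representation of the set represented by `X` in which the names of an
element are the enumerations of its names in `X`. -/
noncomputable def enumRep (X : StabRep.{u, v}) : TTERep.{u} where
  carrier := X.carrier
  rep := X.enumPFun
  surj s := by
    obtain ⟨a, ha⟩ := X.surj s
    obtain ⟨p, hp⟩ := exists_enumerates a
    exact ⟨p, mem_enumPFun.2 ⟨a, hp, ha⟩⟩

end StabRep

variable {U : CohSpace.{v}} (i : baireSpace.{v}.coh ↪r U.coh)

theorem isDiscreteRel_name : IsDiscreteRel fun p a => a = name i p :=
  fun _ _ _ hp hq => name_injective i (hp.symm.trans hq)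

/-- The coherent representation over `U` whose names are the images of the graphs of the names
of a Baire-space representation. -/
noncomputable abbrev nameRep (A : TTERep.{u}) : StabRep.{u, v} :=
  inducedRep (fun p a => a = name i p) (fun _ => ⟨_, rfl⟩) (isDiscreteRel_name i) A

theorem mem_nameRep {A : TTERep.{u}} {a : U.Clique} {s : A.carrier} :
    s ∈ (nameRep i A).rep a ↔ ∃ p, a = name i p ∧ s ∈ A.rep p :=
  mem_inducedPFun (isDiscreteRel_name i) A a s

theorem stablyRealizable_nameRep {A B : TTERep.{u}} {f : A.carrier → B.carrier}
    (hf : ContinuouslyRealizable A B f) : StablyRealizable (nameRep i A) (nameRep i B) f := by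
  obtain ⟨D, G, hG, h⟩ := hf
  obtain ⟨F, hF, hFG⟩ := exists_stable_of_continuousOn i hG
  refine ⟨F, hF, fun a s hs => ?_⟩
  obtain ⟨p, rfl, hp⟩ := (mem_nameRep i).1 hs
  obtain ⟨hD, hGp⟩ := h p s hp
  exact (mem_nameRep i).2 ⟨G p, hFG p hD, hGp⟩

/-- The hom-set bijection of the adjunction. A stable realizer is followed by enumeration of its
values; a continuous one is made stable on names and followed by listing. -/
theorem stablyRealizable_nameRep_iff {A : TTERep.{u}} {X : StabRep.{u, v}}
    {f : A.carrier → X.carrier} :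
    StablyRealizable (nameRep i A) X f ↔ ContinuouslyRealizable A X.enumRep f := by
  constructor
  · rintro ⟨F, hF, h⟩
    obtain ⟨G, hG, hGF⟩ := hF.exists_continuous_enumerates_name i
    refine ⟨Set.univ, G, hG.continuousOn, fun p s hp => ⟨trivial, ?_⟩⟩
    exact StabRep.mem_enumPFun.2 ⟨_, hGF p, h _ s ((mem_nameRep i).2 ⟨p, rfl, hp⟩)⟩
  · rintro ⟨D, G, hG, h⟩
    obtain ⟨F, hF, hFG⟩ := exists_stable_of_continuousOn i hG
    obtain ⟨K, hK, hKe⟩ := exists_stable_listing i X.space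
    refine ⟨_, hK.comp hF, fun a s hs => ?_⟩
    obtain ⟨p, rfl, hp⟩ := (mem_nameRep i).1 hs
    obtain ⟨hD, hGp⟩ := h p s hp
    obtain ⟨b, hb, hsb⟩ := StabRep.mem_enumPFun.1 hGp
    rw [hFG p hD, hKe _ b hb]
    exact hsb

/-- Decoding after the realizer removes the passage through names; this is fullness of the left
adjoint. -/
theorem ContinuouslyRealizable.of_enumRep_nameRep {A B : TTERep.{u}} {f : A.carrier → B.carrier}
    (hf : ContinuouslyRealizable A (nameRep i B).enumRep f) : ContinuouslyRealizable A B f := by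
  obtain ⟨D, F, hF, h⟩ := hf
  obtain ⟨E, G, hG, hGn⟩ := exists_continuousOn_decoding i
  refine ⟨D ∩ F ⁻¹' E, fun p => G (F p),
    hG.comp (hF.mono Set.inter_subset_left) fun p hp => hp.2, fun p s hp => ?_⟩
  obtain ⟨hD, hFp⟩ := h p s hp
  obtain ⟨a, ha, hs⟩ := StabRep.mem_enumPFun.1 hFp
  obtain ⟨q, rfl, hq⟩ := (mem_nameRep i).1 hs
  obtain ⟨hE, hGq⟩ := hGn q _ ha
  obtain rfl := hGq
  exact ⟨⟨hD, hE⟩, hq⟩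

/-- The functor that sends a Baire-space representation to the coherent representation by the
names in `U`. -/
noncomputable abbrev nameFunctor : TTERep.{u} ⥤ StabRep.{u, v} :=
  inducedRepFunctor (fun p a => a = name i p) (fun _ => ⟨_, rfl⟩) (isDiscreteRel_name i)
    fun _ _ _ => stablyRealizable_nameRep i

instance : (nameFunctor.{u} i).Faithful where
  map_injective h := Subtype.ext (congrArg Subtype.val h :)

instance : (nameFunctor.{u} i).Full where
  map_surjective f :=
    ⟨⟨f.1, .of_enumRep_nameRep i ((stablyRealizable_nameRep_iff i).1 f.2)⟩, rfl⟩

/-- The functor `nameFunctor` has a right adjoint. -/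
noncomputable def nameFunctorAdjunction : nameFunctor.{u} i ⊣
    Adjunction.rightAdjointOfEquiv (F := nameFunctor.{u} i) (G_obj := StabRep.enumRep)
      (fun _ _ => Equiv.subtypeEquivRight fun _ => stablyRealizable_nameRep_iff i)
      -- Transposition does not change the underlying function, so naturality is definitional.
      fun _ _ _ _ _ => rfl :=
  Adjunction.adjunctionOfEquivRight _ _

/-- The inclusion of the essential image of a fully faithful left adjoint is coreflective. -/
@[reducible]
noncomputable def CategoryTheory.Adjunction.coreflectiveEssImage {C D : Type*} [Category C]
    [Category D] {L : C ⥤ D} {R : D ⥤ C} (adj : L ⊣ R) [L.Full] [L.Faithful] :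
    Coreflective L.essImage.ι where
  R := R ⋙ L.toEssImage
  -- The inverse of the equivalence onto the essential image, followed by `L`, is isomorphic to the
  -- inclusion; the adjunction is transported along this isomorphism.
  adj := (L.toEssImage.asEquivalence.symm.toAdjunction.comp adj).ofNatIsoLeft
    (Functor.isoWhiskerLeft L.toEssImage.inv L.toEssImageCompι.symm ≪≫
      (Functor.associator _ _ _).symm ≪≫
      Functor.isoWhiskerRight L.toEssImage.asEquivalence.counitIso L.essImage.ι ≪≫
      Functor.leftUnitor _)

theorem exists_coreflective_nameFunctor :
    ∃ (P : ObjectProperty StabRep.{u, v}) (E : TTERep.{u} ≌ P.FullSubcategory),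
      Nonempty (Coreflective P.ι) ∧ Nonempty (E.functor ⋙ P.ι ≅ nameFunctor i) :=
  ⟨(nameFunctor i).essImage, (nameFunctor i).toEssImage.asEquivalence,
    ⟨(nameFunctorAdjunction i).coreflectiveEssImage⟩, ⟨(nameFunctor i).toEssImageCompι⟩⟩

theorem mainTheorem10 :
    -- `TTERep` is equivalent to a full coreflective subcategory of `StabRep`
    (∃ P : ObjectProperty StabRep.{u, v},
      Nonempty (Coreflective P.ι) ∧ Nonempty (TTERep.{u} ≌ P.FullSubcategory)) ∧
    -- the combinatory algebras exist
    kleeneSecond.IsPCA ∧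
    (∃ U : CohSpace.{v}, U.IsUniversal) ∧
    ∀ U : CohSpace.{v}, U.IsUniversal → ∀ e : (U.stableHom U).coh ↪r U.coh,
      (cohAlgebra U e).IsPCA ∧
      -- there is an applicative retraction between them
      ∃ (δ : Baire → U.Clique → Prop) (γ : U.Clique → Baire → Prop),
        kleeneSecond.IsApplicativeRetraction (cohAlgebra U e) δ γ ∧
        -- and it induces an equivalence with a full coreflective subcategory
        ∃ (ht : ∀ p, ∃ a, δ p a) (hd : IsDiscreteRel δ)
          (hr : ∀ (A B : TTERep.{u}) (f : A.carrier → B.carrier),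
            ContinuouslyRealizable A B f →
              StablyRealizable (inducedRep δ ht hd A) (inducedRep δ ht hd B) f)
          (P : ObjectProperty StabRep.{u, v}) (E : TTERep.{u} ≌ P.FullSubcategory),
            Nonempty (Coreflective P.ι) ∧
            Nonempty (E.functor ⋙ P.ι ≅ inducedRepFunctor δ ht hd hr) := by
  refine ⟨?_, kleeneSecond_isPCA, ⟨_, universalSpace_isUniversal⟩, fun U hU e => ?_⟩
  · obtain ⟨i⟩ := universalSpace_isUniversal baireSpace
    obtain ⟨P, E, hP, -⟩ := exists_coreflective_nameFunctor i
    exact ⟨P, hP, ⟨E⟩⟩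
  -- Universality enters the retraction only through an embedding of `baireSpace`.
  · obtain ⟨i⟩ := hU baireSpace
    exact ⟨cohAlgebra_isPCA e, _, _, isApplicativeRetraction_name_enumerates i e, _, _, _,
      exists_coreflective_nameFunctor i⟩
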